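/- Let $\mathcal{A}$ be a finite set of linear hyperplanes in $\mathbb{R}^d$ with $\bigcap_{H\in\mathcal{A}}H=\{0\}$, and let $L$ be the set of all intersections of subsets of $\mathcal{A}$ (the empty intersection being $\mathbb{R}^d$); $L_2$ denotes the set of elements of $L$ of codimension two. For $X\in L$ let $\mathcal{A}_X=\{H/X : H\in\mathcal{A},\ H\supseteq X\}$, an arrangement in $\mathbb{R}^d/X$. A line $\ell\in L$ is a modular coatom of $\mathcal{A}$ if for all distinct $H,H'\in\mathcal{A}$ not containing $\ell$ some $H''\in\mathcal{A}$ contains both $\ell$ and $H\cap H'$. The arrangement $\mathcal{A}$ is supersolvable if $d=1$ or if it has a modular coatom $\ell$ for which $\mathcal{A}_\ell$ is supersolvable. A modular flag is a chain $F$: $\{0\}=X_0\subset X_1\subset\cdots\subset X_d=\mathbb{R}^d$ of elements of $L$ with $\dim X_i=i$ such that $X_i/X_{i-1}$ is a modular coatom of $\mathcal{A}_{X_{i-1}}$ for $i=1,\dots,d$. Chambers are the connected components of $\mathbb{R}^d\setminus\bigcup_{H\in\mathcal{A}}H$. For chambers $c,c'$ let $L_1(c,c')$ be the set of $H\in\mathcal{A}$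 separating $c$ from $c'$, and let $G_1$ be the graph on the chambers in which $c,c'$ are adjacent when $|L_1(c,c')|=1$. A minimal gallery from $c$ to $c'$ is a shortest path from $c$ to $c'$ in $G_1$. A chamber $c$ is incident to $F$ if, for every $i$, the cone $\overline{c}\cap X_i$ has dimension $i$. A minimal gallery is incident to $F$ if, whenever $i<j$, it crosses those hyperplanes containing $X_j$ that it crosses before those hyperplanes containing $X_i$ but not $X_j$ that it crosses. For $X\in L$ and a chamber $b$ let $b/X$ be the chamber of $\mathcal{A}_X$ containing the image of $b$, and for a minimal gallery $r=(b_0,\dots,b_m)$ let $r/X$ be the sequence $b_0/X,\dots,b_m/X$ with consecutive repetitions deleted. For minimal galleries $r,r'$ from $c$ to $c'$ let $L_2(r,r')$ be the set of $X\in L_2$ such that every $H\in\mathcal{A}$ containing $X$ separates $c$ from $c'$ and $r/X\neq r'/X$. Let $G_2(c,c')$ be the graph on the minimal galleries from $c$ to $c'$ in which $r,r'$ are adjacent when $|L_2(r,r')|=1$. \textbf{Theorem.} Suppose $\mathcal{A}$ is supersolvable, let $F$ be a modular flag for $\mathcal{A}$, let $c_0$ be a chamber incident to $F$, and let $c$ be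 any chamber. Then: (i) there is a unique minimal gallery $r_0$ from $c_0$ to $c$ incident to $F$; (ii) $r_0$ is $L_2$-accessible in $G_2(c_0,c)$, that is, the graph distance satisfies $d_{G_2(c_0,c)}(r_0,r)=|L_2(r_0,r)|$ for every minimal gallery $r$ from $c_0$ to $c$ (in particular, every such $r$ is joined to $r_0$ by a path). -/

import Mathlib

universe u

/-! Central hyperplane arrangements in a real vector space `V` are sets of linear hyperplanes. -/
namespace Arrangement

section Lattice

variable {V : Type u} [AddCommGroup V] [Module ℝ V]

/-- A finite set of linear hyperplanes whose common intersection is zero. -/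
structure IsCentralEssential (A : Set (Submodule ℝ V)) : Prop where
  finite : A.Finite
  hyperplane : ∀ H ∈ A, Module.finrank ℝ H + 1 = Module.finrank ℝ V
  essential : sInf A = ⊥

/-- The intersection lattice `L`: all intersections of subsets of `A`
(the empty intersection is the whole space). -/
def flats (A : Set (Submodule ℝ V)) : Set (Submodule ℝ V) :=
  {X | ∃ S ⊆ A, X = sInf S}

/-- The rank-`k` part `L_k` of the intersection lattice: the flats of codimension `k`. -/
def flatsOfRank (A : Set (Submodule ℝ V)) (k : ℕ) : Set (Submodule ℝ V) :=
  {X | X ∈ flats A ∧ Module.finrank ℝ X + k = Module.finrank ℝ V}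

/-- The localized arrangement `A_X = {H / X : H ∈ A, X ⊆ H}` in the quotient `V / X`. -/
def localization (A : Set (Submodule ℝ V)) (X : Submodule ℝ V) : Set (Submodule ℝ (V ⧸ X)) :=
  {K | ∃ H ∈ A, X ≤ H ∧ K = H.map X.mkQ}

/-- A modular coatom: a line `ℓ` of the intersection lattice such that, for every two distinct
hyperplanes of `A` not containing `ℓ`, the sum of `ℓ` and their intersection lies in some
hyperplane of `A`. -/
structure IsModularCoatom (A : Set (Submodule ℝ V)) (l : Submodule ℝ V) : Prop where
  mem_flats : l ∈ flats A
  finrank_eq_one : Module.finrank ℝ l = 1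
  modular : ∀ H ∈ A, ∀ H' ∈ A, H ≠ H' → ¬ l ≤ H → ¬ l ≤ H' →
    ∃ H'' ∈ A, l ≤ H'' ∧ H ⊓ H' ≤ H''

end Lattice

/-- Supersolvability of a (central, essential) arrangement: either the ambient space has
dimension one, or there is a modular coatom whose localization is supersolvable. -/
inductive IsSupersolvable :
    ∀ {V : Type u} [AddCommGroup V] [Module ℝ V], Set (Submodule ℝ V) → Prop
  | rankOne {V : Type u} [AddCommGroup V] [Module ℝ V] (A : Set (Submodule ℝ V))
      (hV : Module.finrank ℝ V = 1) : IsSupersolvable A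
  | step {V : Type u} [AddCommGroup V] [Module ℝ V] (A : Set (Submodule ℝ V))
      (l : Submodule ℝ V) (hl : IsModularCoatom A l)
      (hloc : IsSupersolvable (localization A l)) : IsSupersolvable A

section Flags

variable {V : Type u} [AddCommGroup V] [Module ℝ V]

/-- A maximal flag `0 = X₀ ⊂ X₁ ⊂ ⋯ ⊂ X_d = V` of flats of `A` with `dim X_i = i`. -/
structure IsFlag (A : Set (Submodule ℝ V)) {d : ℕ} (X : Fin (d + 1) → Submodule ℝ V) :
    Prop where
  mem_flats : ∀ i, X i ∈ flats A
  strictMono : StrictMono X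
  bot : X 0 = ⊥
  top : X (Fin.last d) = ⊤
  finrank_eq : ∀ i, Module.finrank ℝ (X i) = (i : ℕ)

/-- A modular flag: for `i = 1, …, d`, the line `X_i / X_{i-1}` is a modular coatom of the
localization of `A` at `X_{i-1}`. -/
structure IsModularFlag (A : Set (Submodule ℝ V)) {d : ℕ} (X : Fin (d + 1) → Submodule ℝ V) :
    Prop extends IsFlag A X where
  modular : ∀ i : Fin d, IsModularCoatom (localization A (X i.castSucc))
    ((X i.succ).map (X i.castSucc).mkQ)

end Flags

section Chambers

variable {V : Type u} [AddCommGroup V] [Module ℝ V] [TopologicalSpace V]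

/-- The complement of the union of the hyperplanes. -/
def complement (A : Set (Submodule ℝ V)) : Set V := {x | ∀ H ∈ A, x ∉ H}

/-- A chamber: a connected component of the complement of `A`. -/
def IsChamber (A : Set (Submodule ℝ V)) (c : Set V) : Prop :=
  ∃ x ∈ complement A, c = connectedComponentIn (complement A) x

/-- The type of chambers of `A`. -/
def Chamber (A : Set (Submodule ℝ V)) : Type u := {c : Set V // IsChamber A c}

/-- `H` separates `c` from `c'`: they lie in opposite open half-spaces bounded by `H`. -/
def Separates (H : Submodule ℝ V) (c c' : Set V) : Prop :=
  ∃ f : V →ₗ[ℝ] ℝ, LinearMap.ker f = H ∧ (∀ x ∈ c, 0 < f x) ∧ (∀ x ∈ c', f x < 0)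

theorem Separates.symm {H : Submodule ℝ V} {c c' : Set V} (h : Separates H c c') :
    Separates H c' c := by
  obtain ⟨f, hf, h1, h2⟩ := h
  refine ⟨-f, ?_, fun x hx => ?_, fun x hx => ?_⟩
  · rw [← hf]; ext x; simp
  · simpa using h2 x hx
  · simpa using h1 x hx

theorem Chamber.nonempty {A : Set (Submodule ℝ V)} (c : Chamber A) : c.1.Nonempty := by
  obtain ⟨x, hx, hc⟩ := c.2
  exact ⟨x, hc ▸ mem_connectedComponentIn hx⟩

/-- The separation set `L₁(c, c')`. -/
def sepHyperplanes (A : Set (Submodule ℝ V)) (c c' : Chamber A) : Set (Submodule ℝ V) :=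
  {H | H ∈ A ∧ Separates H c.1 c'.1}

theorem sepHyperplanes_comm (A : Set (Submodule ℝ V)) (c c' : Chamber A) :
    sepHyperplanes A c c' = sepHyperplanes A c' c := by
  ext H
  exact ⟨fun h => ⟨h.1, h.2.symm⟩, fun h => ⟨h.1, h.2.symm⟩⟩

theorem sepHyperplanes_self (A : Set (Submodule ℝ V)) (c : Chamber A) :
    sepHyperplanes A c c = ∅ := by
  ext H
  simp only [Set.mem_empty_iff_false, iff_false]
  rintro ⟨-, f, -, h1, h2⟩
  obtain ⟨x, hx⟩ := c.nonempty
  exact lt_asymm (h1 x hx) (h2 x hx)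

/-- The graph `G₁` on chambers: adjacent means separated by exactly one hyperplane. -/
def chamberGraph (A : Set (Submodule ℝ V)) : SimpleGraph (Chamber A) where
  Adj c c' := (sepHyperplanes A c c').encard = 1
  symm := ⟨fun c c' h => by rwa [sepHyperplanes_comm]⟩
  loopless := ⟨fun c h => by simp [sepHyperplanes_self] at h⟩

/-- `c` is incident to the subspace `X`: the cone `closure c ∩ X` has the dimension of `X`
(the dimension of a cone is that of its linear span). -/
def IncidentTo {A : Set (Submodule ℝ V)} (c : Chamber A) (X : Submodule ℝ V) : Prop :=
  Module.finrank ℝ (Submodule.span ℝ (closure c.1 ∩ (X : Set V))) = Module.finrank ℝ X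

theorem mk_mem_complement {A : Set (Submodule ℝ V)} (X : Submodule ℝ V) {x : V}
    (hx : x ∈ complement A) : X.mkQ x ∈ complement (localization A X) := by
  rintro K ⟨H, hH, hXH, rfl⟩ ⟨y, hy, hyx⟩
  have h : y - x ∈ X := by
    rw [Submodule.mkQ_apply, Submodule.mkQ_apply] at hyx
    exact (Submodule.Quotient.eq X).1 hyx
  apply hx H hH
  have := H.sub_mem hy (hXH h)
  simpa using this

/-- The chamber `c / X` of the localization `A_X`: the connected component, in the complement
of `A_X`, containing the classes modulo `X` of the points of `c`. -/
def Chamber.quot {A : Set (Submodule ℝ V)} (c : Chamber A) (X : Submodule ℝ V) :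
    Chamber (localization A X) :=
  ⟨{y | ∃ x ∈ c.1, y ∈ connectedComponentIn (complement (localization A X)) (X.mkQ x)}, by
    obtain ⟨x, hx, hc⟩ := c.2
    refine ⟨X.mkQ x, mk_mem_complement X hx, ?_⟩
    have hcont : Continuous X.mkQ := continuous_quot_mk
    have key : ∀ z ∈ c.1, connectedComponentIn (complement (localization A X)) (X.mkQ x) =
        connectedComponentIn (complement (localization A X)) (X.mkQ z) := by
      intro z hz
      apply connectedComponentIn_eq
      have hpre : IsPreconnected (X.mkQ '' c.1) := by
        rw [hc]
        exact isPreconnected_connectedComponentIn.image _ hcont.continuousOn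
      refine hpre.subset_connectedComponentIn ⟨x, ?_, rfl⟩ ?_ ⟨z, hz, rfl⟩
      · rw [hc]; exact mem_connectedComponentIn hx
      · rintro _ ⟨w, hw, rfl⟩
        rw [hc] at hw
        exact mk_mem_complement X (connectedComponentIn_subset _ _ hw)
    ext y
    constructor
    · rintro ⟨z, hz, hy⟩
      rwa [key z hz]
    · intro hy
      exact ⟨x, by rw [hc]; exact mem_connectedComponentIn hx, hy⟩⟩

/-- The set `R(c, c')` of minimal galleries: shortest walks from `c` to `c'` in `G₁`. -/
def MinimalGallery (A : Set (Submodule ℝ V)) (c c' : Chamber A) : Type u :=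
  {r : (chamberGraph A).Walk c c' // r.length = (chamberGraph A).dist c c'}

variable {A : Set (Submodule ℝ V)} {c c' : Chamber A}

/-- The gallery `r` crosses `H` in its `i`-th step (counting from zero). -/
def MinimalGallery.CrossesAt (r : MinimalGallery A c c') (i : ℕ) (H : Submodule ℝ V) : Prop :=
  i < r.1.length ∧ H ∈ sepHyperplanes A (r.1.getVert i) (r.1.getVert (i + 1))

/-- The gallery `r` is incident to the flag `X`: whenever `i < j`, the hyperplanes containing
`X_j` that `r` crosses are crossed before those containing `X_i` but not `X_j`. -/
def MinimalGallery.IncidentToFlag (r : MinimalGallery A c c') {d : ℕ}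
    (X : Fin (d + 1) → Submodule ℝ V) : Prop :=
  ∀ i j : Fin (d + 1), i < j → ∀ H ∈ A, ∀ H' ∈ A, X j ≤ H → X i ≤ H' → ¬ X j ≤ H' →
    ∀ a b : ℕ, r.CrossesAt a H → r.CrossesAt b H' → a < b

open Classical in
/-- The induced gallery `r / X` of the localization `A_X`: the sequence of chambers `c_i / X`
with consecutive repetitions deleted. -/
noncomputable def MinimalGallery.quot (r : MinimalGallery A c c') (X : Submodule ℝ V) :
    List (Chamber (localization A X)) :=
  (r.1.support.map fun b => b.quot X).destutter (· ≠ ·)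

/-- The set `L₂(c, c')` of codimension-two flats `X` such that every hyperplane of `A`
containing `X` separates `c` from `c'`. -/
def sepFlats (A : Set (Submodule ℝ V)) (c c' : Chamber A) : Set (Submodule ℝ V) :=
  {X | X ∈ flatsOfRank A 2 ∧ ∀ H ∈ A, X ≤ H → H ∈ sepHyperplanes A c c'}

/-- The separation set `L₂(r, r')`: the flats in `L₂(c, c')` with `r / X ≠ r' / X`. -/
def gallerySep (r r' : MinimalGallery A c c') : Set (Submodule ℝ V) :=
  {X | X ∈ sepFlats A c c' ∧ r.quot X ≠ r'.quot X}

variable (A c c') in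
/-- The graph `G₂(c, c')` on the minimal galleries from `c` to `c'`: adjacent means separated by
exactly one codimension-two flat. -/
def galleryGraph : SimpleGraph (MinimalGallery A c c') where
  Adj r r' := (gallerySep r r').encard = 1
  symm := ⟨fun r r' h => by
    have : gallerySep r' r = gallerySep r r' := by
      ext X; simp only [gallerySep, Set.mem_ofPred_eq, ne_comm]
    rwa [this]⟩
  loopless := ⟨fun r h => by simp [gallerySep] at h⟩

end Chambers

/-- A vertex `x₀` is `Ω`-accessible if `d_G(x₀, y) = |Ω(x₀, y)|` for every vertex `y`.
Distances are extended: they are `⊤` between different components. -/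
def IsAccessible {W : Type*} {S : Type*} (G : SimpleGraph W) (Om : W → W → Set S) (x₀ : W) :
    Prop :=
  ∀ y, G.edist x₀ y = (Om x₀ y).encard

end Arrangement

/-! Choose for every hyperplane a form that is positive on c₀. A chamber is then encoded by its set
of negative forms, c₀ by the empty set, and a minimal gallery from c₀ to c by an ordering of the
negative forms of c each of whose prefixes is the set of a chamber.

The flag makes these orderings tractable. Grade a form by the largest i such that it vanishes on
X_i. Incidence of c₀ gives vectors `w i` in X_{i+1} on which the forms of class i are positive, and
modularity says that the slopes `f h y / f h (w i)` of two forms of class i differ by a nonzero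
multiple of a form of higher class. So signs of higher class decide how the hyperplanes of class i
are ordered along `w i`, while moving along `w i` disturbs no higher class. Building a point from
the top class downwards shows that every biclosed set is the set of a chamber (`exists_realizes`);
minimal galleries become admissible lists.

A gallery is incident to the flag when the classes in its list weakly decrease. Then, inside one
class, everything of higher class has already been crossed, so the order has to be the slope order
at a point of c. This gives uniqueness (`sorted_unique`), and sorting by class and slope gives
existence (`exists_sorted`).

For accessibility, |L₂(r₀, r)| bounds the distance from below because an edge changes one flat only.
Conversely, if r is not incident to the flag, take its first ascent of class, e followed by k. In
the pencil spanned by e and k only k differs in class from e, and the pencil is crossed in one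
consecutive block ending in k (`mem_of_inPencil`, `pairwise_inPencil`). Reversing the block changes
r at a single codimension-two flat and brings k to the front of the pencil, where r₀ has it; this
forces agreement with r₀ at that flat (`exists_flip`). L₂(r₀, r) thus loses exactly one element, and
induction applies. -/

namespace Arrangement

/-! ### Biclosed sets of forms graded by a flag, and their realization by points -/

section Forms

variable {ι : Type*} {V : Type*} [AddCommGroup V] [Module ℝ V]

/-- The point `y` lies off all the hyperplanes `f h = 0`, and `T` is the set of those
that have `y` on their negative side. -/
def Realizes (f : ι → V →ₗ[ℝ] ℝ) (y : V) (T : Set ι) : Prop :=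
  ∀ h, f h y ≠ 0 ∧ (f h y < 0 ↔ h ∈ T)

/-- Both `T` and its complement are closed under positive combinations of two forms. -/
def IsBiclosed (f : ι → V →ₗ[ℝ] ℝ) (T : Set ι) : Prop :=
  ∀ h g k : ι, ∀ a b : ℝ, 0 < a → 0 < b → f h = a • f g + b • f k →
    (g ∈ T → k ∈ T → h ∈ T) ∧ (g ∉ T → k ∉ T → h ∉ T)

/-- The slope of the form `f h` at `y` along the vector attached to its class. -/
noncomputable def slope (f : ι → V →ₗ[ℝ] ℝ) (cls : ι → ℕ) (w : ℕ → V) (h : ι) (y : V) : ℝ :=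
  f h y / f h (w (cls h))

/-- Linear forms graded by a modular flag: `cls h` is the dimension of the largest member of the
flag on which `f h` vanishes, and `w i` is a vector of the next member on which the forms of
class `i` are positive. -/
structure IsFlagged (f : ι → V →ₗ[ℝ] ℝ) (cls : ι → ℕ) (w : ℕ → V) : Prop where
  apply_of_lt : ∀ h i, i < cls h → f h (w i) = 0
  apply_pos : ∀ h, 0 < f h (w (cls h))
  modular : ∀ h g, h ≠ g → cls h = cls g → ∃ k, cls h < cls k ∧ ∃ t : ℝ, t ≠ 0 ∧
    ∀ y, slope f cls w h y - slope f cls w g y = t * f k y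
  eq_of_smul : ∀ h g (a : ℝ), f h = a • f g → h = g

variable {f : ι → V →ₗ[ℝ] ℝ} {cls : ι → ℕ} {w : ℕ → V}

theorem Realizes.pos {y : V} {T : Set ι} (hy : Realizes f y T) {h : ι} (hh : h ∉ T) :
    0 < f h y :=
  lt_of_le_of_ne (not_lt.1 fun hn => hh ((hy h).2.1 hn)) (hy h).1.symm

theorem Realizes.neg {y : V} {T : Set ι} (hy : Realizes f y T) {h : ι} (hh : h ∈ T) :
    f h y < 0 := (hy h).2.2 hh

theorem Realizes.isBiclosed {y : V} {T : Set ι} (hy : Realizes f y T) : IsBiclosed f T := by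
  intro h g k a b ha hb e
  have e' : f h y = a * f g y + b * f k y := by simp [e]
  refine ⟨fun hg hk => (hy h).2.1 ?_, fun hg hk hh => ?_⟩
  · have := mul_neg_of_pos_of_neg ha (hy.neg hg)
    have := mul_neg_of_pos_of_neg hb (hy.neg hk)
    linarith
  · have := mul_pos ha (hy.pos hg)
    have := mul_pos hb (hy.pos hk)
    linarith [hy.neg hh]

namespace IsFlagged

theorem slope_neg_iff (hf : IsFlagged f cls w) (h : ι) (y : V) :
    slope f cls w h y < 0 ↔ f h y < 0 := by
  rw [slope, div_lt_iff₀ (hf.apply_pos h), zero_mul]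

theorem slope_pos_iff (hf : IsFlagged f cls w) (h : ι) (y : V) :
    0 < slope f cls w h y ↔ 0 < f h y := by
  rw [slope, lt_div_iff₀ (hf.apply_pos h), zero_mul]

/-- Moving along the vector of a class shifts all slopes of that class equally; this is the one
degree of freedom used per class to realize a biclosed set. -/
theorem slope_sub_smul (hf : IsFlagged f cls w) (h : ι) (y : V) (t : ℝ) :
    slope f cls w h (y - t • w (cls h)) = slope f cls w h y - t := by
  have := (hf.apply_pos h).ne'
  simp only [slope, map_sub, map_smul, smul_eq_mul]
  field_simp

/-- If `h` is crossed but `g` is not at `z`, and `z` and `y` lie on the same side of the hyperplane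
spanned by `w` and the intersection of `h` and `g`, then `h` has the smaller slope at `y`. -/
theorem slope_lt_of_mem (hf : IsFlagged f cls w) {h g k : ι} {t : ℝ}
    (ht : ∀ y, slope f cls w h y - slope f cls w g y = t * f k y)
    {z y : V} {T U : Set ι} (hz : Realizes f z T) (hy : Realizes f y U)
    (hh : h ∈ T) (hg : g ∉ T) (hk : k ∈ T ↔ k ∈ U) :
    slope f cls w h y < slope f cls w g y := by
  have h1 := (hf.slope_neg_iff h z).2 (hz.neg hh)
  have h2 := (hf.slope_pos_iff g z).2 (hz.pos hg)
  have h3 : t * f k z < 0 := by rw [← ht]; linarith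
  suffices t * f k y < 0 by rw [← ht] at this; linarith
  by_cases hkT : k ∈ T
  · have e1 := hz.neg hkT
    have e2 := hy.neg (hk.1 hkT)
    have : 0 < t := by by_contra hn; nlinarith
    nlinarith
  · have e1 := hz.pos hkT
    have e2 := hy.pos (fun h => hkT (hk.2 h))
    nlinarith [neg_of_mul_neg_left h3 e1.le]

theorem apply_eq (hf : IsFlagged f cls w) (h : ι) (y : V) :
    f h y = f h (w (cls h)) * slope f cls w h y := by
  have := (hf.apply_pos h).ne'
  rw [slope]; field_simp

/-- Biclosed sets separate the forms of one class by their slopes. -/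
theorem slope_lt_of_isBiclosed (hf : IsFlagged f cls w) {T : Set ι} (hT : IsBiclosed f T)
    {y : V} {h g : ι} (hc : cls h = cls g)
    (hy : ∀ k, cls h < cls k → f k y ≠ 0 ∧ (f k y < 0 ↔ k ∈ T)) (hh : h ∈ T) (hg : g ∉ T) :
    slope f cls w h y < slope f cls w g y := by
  have hne : h ≠ g := fun e => hg (e ▸ hh)
  obtain ⟨k, hk, t, ht0, ht⟩ := hf.modular h g hne hc
  obtain ⟨hk0, hkT⟩ := hy k hk
  by_contra! hle
  have hpos : 0 < t * f k y := by
    rw [← ht]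
    refine lt_of_le_of_ne (by linarith) ?_
    rw [ht]
    exact (mul_ne_zero ht0 hk0).symm
  have ph := hf.apply_pos h
  have pg := hf.apply_pos g
  -- If the slopes were in the wrong order, `f g` would be a positive combination of `f h` and `f k`
  -- when `k ∈ T`, and `f h` one of `f g` and `f k` when `k ∉ T`; each contradicts biclosedness.
  by_cases hkm : k ∈ T
  · have hky := hkT.2 hkm
    have htn : t < 0 := by nlinarith
    refine hg ((hT g h k (f g (w (cls g)) / f h (w (cls h))) (f g (w (cls g)) * (-t))
      (div_pos pg ph) (mul_pos pg (by linarith)) ?_).1 hh hkm)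
    ext z
    have := ht z
    simp only [LinearMap.add_apply, LinearMap.smul_apply, smul_eq_mul]
    have e : slope f cls w g z = slope f cls w h z - t * f k z := by linarith
    rw [hf.apply_eq g z, e, slope]
    ring
  · have hky : 0 < f k y := lt_of_le_of_ne (not_lt.1 fun h => hkm (hkT.1 h)) hk0.symm
    have htp : 0 < t := by nlinarith
    refine (hT h g k (f h (w (cls h)) / f g (w (cls g))) (f h (w (cls h)) * t)
      (div_pos ph pg) (mul_pos ph htp) ?_).2 hg hkm hh
    ext z
    have := ht z
    simp only [LinearMap.add_apply, LinearMap.smul_apply, smul_eq_mul]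
    have e : slope f cls w h z = slope f cls w g z + t * f k z := by linarith
    rw [hf.apply_eq h z, e, slope]
    ring

/-- Every biclosed set is realized by a point. -/
theorem exists_realizes [Finite ι] (hf : IsFlagged f cls w) {T : Set ι} (hT : IsBiclosed f T) :
    ∃ y, Realizes f y T := by
  classical
  have := Fintype.ofFinite ι
  let P : ℕ → Prop := fun i => ∃ y, ∀ h, i ≤ cls h → f h y ≠ 0 ∧ (f h y < 0 ↔ h ∈ T)
  have step : ∀ i, P (i + 1) → P i := by
    -- Biclosedness puts the slopes of class `i` in `T` below those outside `T`. Subtracting `t • w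
    -- i`, with `t` strictly between, gives class `i` the right signs and leaves the higher classes
    -- alone.
    rintro i ⟨y, hy⟩
    obtain ⟨t, ht1, ht2⟩ := Order.exists_between_finsets
      ((Finset.univ.filter fun h => cls h = i ∧ h ∈ T).image fun h => slope f cls w h y)
      ((Finset.univ.filter fun h => cls h = i ∧ h ∉ T).image fun h => slope f cls w h y)
      (by
        simp only [Finset.mem_image, Finset.mem_filter, Finset.mem_univ, true_and]
        rintro _ ⟨h, ⟨h1, h2⟩, rfl⟩ _ ⟨g, ⟨g1, g2⟩, rfl⟩
        exact hf.slope_lt_of_isBiclosed hT (h1.trans g1.symm)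
          (fun k hk => hy k (by omega)) h2 g2)
    simp only [Finset.mem_image, Finset.mem_filter, Finset.mem_univ, true_and,
      forall_exists_index, and_imp] at ht1 ht2
    refine ⟨y - t • w i, fun h hh => ?_⟩
    rcases hh.lt_or_eq with hlt | rfl
    · have e : f h (y - t • w i) = f h y := by simp [hf.apply_of_lt h i hlt]
      rw [e]
      exact hy h hlt
    · have e := hf.slope_sub_smul h y t
      by_cases hm : h ∈ T
      · have : f h (y - t • w (cls h)) < 0 := by
          rw [← hf.slope_neg_iff, e]; linarith [ht1 _ h rfl hm rfl]
        exact ⟨this.ne, iff_of_true this hm⟩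
      · have : 0 < f h (y - t • w (cls h)) := by
          rw [← hf.slope_pos_iff, e]; linarith [ht2 _ h rfl hm rfl]
        exact ⟨this.ne', iff_of_false this.not_gt hm⟩
  obtain ⟨N, hN⟩ := (Set.finite_range cls).bddAbove
  -- Beyond the largest class the condition is empty, so any point will do.
  have base : P (N + 1) := ⟨0, fun h hh => by
    have := hN ⟨h, rfl⟩; omega⟩
  have all : ∀ n, P (N + 1 - n) := by
    intro n
    induction n with
    | zero => exact base
    | succ n ih =>
      rcases Nat.lt_or_ge n (N + 1) with hn | hn
      · apply step
        rwa [show N + 1 - (n + 1) + 1 = N + 1 - n by omega]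
      · rwa [show N + 1 - (n + 1) = N + 1 - n by omega]
  obtain ⟨y, hy⟩ := all (N + 1)
  exact ⟨y, fun h => hy h (by omega)⟩

end IsFlagged

end Forms

/-! ### Prefixes, filters and first ascents of lists -/

section Lists

/-- Admissibility provides information at prefixes; this converts it into pairwise order statements.
-/
theorem pairwise_of_append {α : Type*} {R : α → α → Prop} {l : List α}
    (H : ∀ p q, l = p ++ q → ∀ a ∈ p, ∀ b ∈ q, R a b) : l.Pairwise R := by
  induction l with
  | nil => exact .nil
  | cons x l ih =>
    refine .cons (fun b hb => H [x] l rfl x (by simp) b hb) (ih fun p q e a ha b hb => ?_)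
    exact H (x :: p) q (by simp [e]) a (by simp [ha]) b hb

theorem filter_not_append_filter {α : Type*} (p : α → Bool) {l : List α}
    (h : l.Pairwise fun a b => p a → p b) : l.filter (fun a => !p a) ++ l.filter p = l := by
  induction h with
  | nil => rfl
  | @cons x l hx hl ih =>
    by_cases hp : p x
    · have h1 : l.filter p = l := List.filter_eq_self.2 fun a ha => hx a ha hp
      have h2 : l.filter (fun a => !p a) = [] := by
        rw [List.filter_eq_nil_iff]; intro a ha; simp [hx a ha hp]
      simp [hp, h1, h2]
    · simp [hp, ih]

theorem prefix_append_cases {α : Type*} {p x y : List α} (h : p <+: x ++ y) :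
    p <+: x ∨ ∃ s, s <+: y ∧ p = x ++ s := by
  obtain ⟨r, hr⟩ := h
  rcases List.append_eq_append_iff.1 hr with ⟨s, h1, h2⟩ | ⟨s, h1, h2⟩
  · exact .inl ⟨s, h1.symm⟩
  · exact .inr ⟨s, ⟨r, h2.symm⟩, h1⟩

/-- In a list that is not weakly decreasing there is a weakly decreasing prefix
followed by a larger element. -/
theorem exists_first_ascent {α : Type*} (c : α → ℕ) {l : List α}
    (hl : ¬ l.Pairwise fun a b => c b ≤ c a) :
    ∃ Q e K R, l = Q ++ e :: K :: R ∧ (Q ++ [e]).Pairwise (fun a b => c b ≤ c a) ∧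
      c e < c K := by
  induction l using List.reverseRecOn with
  | nil => simp at hl
  | append_singleton l K ih =>
    by_cases h : l.Pairwise fun a b => c b ≤ c a
    · rcases List.eq_nil_or_concat l with rfl | ⟨Q, e, rfl⟩
      · simp at hl
      · refine ⟨Q, e, K, [], by simp, by simpa using h, ?_⟩
        by_contra! hle
        apply hl
        rw [List.concat_eq_append] at h ⊢
        rw [List.pairwise_append]
        refine ⟨h, by simp, ?_⟩
        simp only [List.mem_append, List.mem_singleton, forall_eq]
        rintro a (ha | rfl)
        · exact hle.trans ((List.pairwise_append.1 h).2.2 a ha e (by simp))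
        · exact hle
    · obtain ⟨Q, e, K', R, rfl, h1, h2⟩ := ih h
      exact ⟨Q, e, K', R ++ [K], by simp, h1, h2⟩

end Lists

/-! ### Admissible lists and the unique one of decreasing class -/

section Forms

variable {ι : Type*} {V : Type*} [AddCommGroup V] [Module ℝ V]

/-- A list of distinct indices all of whose prefixes are biclosed. -/
structure IsAdmissible (f : ι → V →ₗ[ℝ] ℝ) (l : List ι) : Prop where
  nodup : l.Nodup
  biclosed : ∀ p, p <+: l → IsBiclosed f {h | h ∈ p}

variable {f : ι → V →ₗ[ℝ] ℝ} {cls : ι → ℕ} {w : ℕ → V}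

namespace IsFlagged

theorem slope_ne (hf : IsFlagged f cls w) {x : V} {S : Set ι} (hx : Realizes f x S) {h g : ι}
    (hne : h ≠ g) (hc : cls h = cls g) : slope f cls w h x ≠ slope f cls w g x := by
  obtain ⟨k, -, t, ht0, ht⟩ := hf.modular h g hne hc
  rw [← sub_ne_zero, ht]
  exact mul_ne_zero ht0 (hx k).1

variable (f cls w) in
/-- The order in which the gallery incident to the flag crosses hyperplanes on its way to `x`. -/
def Before (x : V) (h g : ι) : Prop :=
  cls g < cls h ∨ cls h = cls g ∧ slope f cls w h x < slope f cls w g x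

theorem Before.asymm {x : V} {h g : ι} (h1 : Before f cls w x h g) (h2 : Before f cls w x g h) :
    False := by
  rcases h1 with h1 | ⟨h1, h1'⟩ <;> rcases h2 with h2 | ⟨h2, h2'⟩
  · omega
  · omega
  · omega
  · exact lt_asymm h1' h2'

/-- If the classes differed, evaluation at `w` of the smaller one would make one side vanish and the
other positive. -/
theorem cls_eq_of_combination (hf : IsFlagged f cls w) {h g k : ι} {a b : ℝ} (ha : 0 < a)
    (hb : 0 < b) (e : f h = a • f g + b • f k) (hgk : cls g ≤ cls k) : cls h = cls g := by
  have e' : ∀ y, f h y = a * f g y + b * f k y := fun y => by simp [e]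
  have hg := hf.apply_pos g
  rcases lt_trichotomy (cls h) (cls g) with hlt | heq | hlt
  · have h1 := e' (w (cls h))
    rw [hf.apply_of_lt g _ hlt, hf.apply_of_lt k _ (hlt.trans_le hgk)] at h1
    have := hf.apply_pos h
    simp at h1
    linarith
  · exact heq
  · have h1 := e' (w (cls g))
    rw [hf.apply_of_lt h _ hlt] at h1
    have : 0 ≤ f k (w (cls g)) := by
      rcases hgk.lt_or_eq with h2 | h2
      · rw [hf.apply_of_lt k _ h2]
      · rw [h2]; exact (hf.apply_pos k).le
    nlinarith [mul_pos ha hg, mul_nonneg hb.le this]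

/-- In a relation `f h = a • f g + b • f k` with `cls g ≤ cls k`, the form `h` has the class of `g`.
If `k` has higher class, the slope of `h` at `x` is that of `g` plus a positive multiple of `f k x`;
if the classes agree, it is a weighted mean of the slopes of `g` and `k`. Either way `h` cannot
violate an initial segment of the order. -/
theorem isBiclosed_of_before (hf : IsFlagged f cls w) {x : V} {S T : Set ι}
    (hx : Realizes f x S) (hTS : T ⊆ S)
    (hb : ∀ h ∈ T, ∀ g ∈ S, g ∉ T → Before f cls w x h g) : IsBiclosed f T := by
  suffices H : ∀ h g k : ι, ∀ a b : ℝ, 0 < a → 0 < b → f h = a • f g + b • f k →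
      cls g ≤ cls k → (g ∈ T → k ∈ T → h ∈ T) ∧ (g ∉ T → k ∉ T → h ∉ T) by
    intro h g k a b ha hb' e
    rcases le_total (cls g) (cls k) with hle | hle
    · exact H h g k a b ha hb' e hle
    · have := H h k g b a hb' ha (by rw [e, add_comm]) hle
      tauto
  intro h g k a b ha hb' e hle
  have hcls := hf.cls_eq_of_combination ha hb' e hle
  have e' : ∀ y, f h y = a * f g y + b * f k y := fun y => by simp [e]
  have ex := e' x
  have ew := e' (w (cls g))
  have sl : ∀ u ∉ S, 0 < slope f cls w u x := fun u hu => (hf.slope_pos_iff u x).2 (hx.pos hu)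
  have sn : ∀ u ∈ S, slope f cls w u x < 0 := fun u hu => (hf.slope_neg_iff u x).2 (hx.neg hu)
  have inT : ∀ u ∈ T, h ∈ S → h ∉ T → cls u = cls h →
      slope f cls w u x < slope f cls w h x := by
    intro u hu hS hT hc
    rcases hb u hu h hS hT with h1 | h1
    · omega
    · exact h1.2
  have notT : ∀ u ∉ T, h ∈ T → cls u = cls h → slope f cls w h x < slope f cls w u x := by
    intro u hu hT hc
    by_cases hS : u ∈ S
    · rcases hb h hT u hS hu with h1 | h1
      · omega
      · exact h1.2
    · exact (sn h (hTS hT)).trans (sl u hS)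
  have pg := mul_pos ha (hf.apply_pos g)
  rw [hf.apply_eq h, hf.apply_eq g, hcls] at ex
  rcases hle.lt_or_eq with hlt | heq
  · rw [hf.apply_of_lt k _ hlt, mul_zero, add_zero] at ew
    rw [ew] at ex
    refine ⟨fun hg hk => ?_, fun hg hk hh => ?_⟩
    · by_contra hh
      have hS := (hx.isBiclosed h g k a b ha hb' e).1 (hTS hg) (hTS hk)
      have h1 := inT g hg hS hh hcls.symm
      have h2 := mul_neg_of_pos_of_neg hb' (hx.neg (hTS hk))
      nlinarith
    · have hkS : k ∉ S := fun hkS => by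
        rcases hb h hh k hkS hk with h1 | h1 <;> omega
      have h1 := notT g hg hh hcls.symm
      have h2 := mul_pos hb' (hx.pos hkS)
      nlinarith
  · have pk := mul_pos hb' (hf.apply_pos k)
    rw [hf.apply_eq k, ew, heq] at ex
    rw [heq] at pg
    refine ⟨fun hg hk => ?_, fun hg hk hh => ?_⟩
    · by_contra hh
      have hS := (hx.isBiclosed h g k a b ha hb' e).1 (hTS hg) (hTS hk)
      have h1 := inT g hg hS hh hcls.symm
      have h2 := inT k hk hS hh (hcls.trans heq).symm
      nlinarith
    · have h1 := notT g hg hh hcls.symm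
      have h2 := notT k hk hh (hcls.trans heq).symm
      nlinarith

theorem exists_sorted [Finite ι] (hf : IsFlagged f cls w) {x : V} {S : Set ι}
    (hx : Realizes f x S) :
    ∃ l, IsAdmissible f l ∧ l.Pairwise (fun h g => cls g ≤ cls h) ∧ ∀ h, h ∈ l ↔ h ∈ S := by
  classical
  -- Lexicographic key: class descending, hence the order dual, then slope ascending. Slopes within
  -- a class are distinct at `x`, so the sorted list is strictly ordered by `Before`.
  let κ : ι → ℕᵒᵈ ×ₗ ℝ := fun h => toLex (OrderDual.toDual (cls h), slope f cls w h x)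
  let r : ι → ι → Prop := fun a b => κ a ≤ κ b
  have : Std.Total r := ⟨fun a b => le_total _ _⟩
  have : IsTrans ι r := ⟨fun a b c => le_trans⟩
  let l := (S.toFinite.toFinset.toList).insertionSort r
  have hperm : l.Perm S.toFinite.toFinset.toList := List.perm_insertionSort r _
  have hnd : l.Nodup := hperm.nodup_iff.2 (Finset.nodup_toList _)
  have hmem : ∀ h, h ∈ l ↔ h ∈ S := fun h => by rw [hperm.mem_iff]; simp
  have hr : l.Pairwise r := List.pairwise_insertionSort r _
  have hB : l.Pairwise (Before f cls w x) := by
    refine (hr.and hnd).imp fun {a b} hab => ?_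
    obtain ⟨h1, h2⟩ := hab
    rw [show r a b ↔ _ from Prod.Lex.toLex_le_toLex] at h1
    rcases h1 with h1 | ⟨h1, h3⟩
    · exact .inl h1
    · exact .inr ⟨h1, lt_of_le_of_ne h3 (hf.slope_ne hx h2 h1)⟩
  refine ⟨l, ⟨hnd, ?_⟩, hB.imp fun {a b} h => ?_, hmem⟩
  · rintro p ⟨q, hq⟩
    refine hf.isBiclosed_of_before hx (fun h hh => (hmem h).1 ?_) fun h hh g hg hgp => ?_
    · rw [← hq]; exact List.mem_append_left _ hh
    · rw [← hq] at hB
      refine (List.pairwise_append.1 hB).2.2 h hh g ?_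
      have := (hmem g).2 hg
      rw [← hq, List.mem_append] at this
      exact this.resolve_left hgp
  · rcases h with h | h
    · exact h.le
    · exact h.1.ge

/-- For `h` before `g` in one class, the form `k` governing their slope difference has higher class.
Since the list is sorted, `k` is not crossed after `h`, so it has the same sign at the prefix
separating `h` from `g` as at `x`, and the slope order can be read off at that prefix. -/
theorem pairwise_before [Finite ι] (hf : IsFlagged f cls w) {x : V} {l : List ι}
    (hl : IsAdmissible f l) (hs : l.Pairwise fun h g => cls g ≤ cls h)
    (hx : Realizes f x {h | h ∈ l}) : l.Pairwise (Before f cls w x) := by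
  refine pairwise_of_append ?_
  rintro p q rfl h hh g hg
  have hle := (List.pairwise_append.1 hs).2.2
  rcases (hle h hh g hg).lt_or_eq with h1 | h1
  · exact .inl h1
  refine .inr ⟨h1.symm, ?_⟩
  have hd := List.disjoint_of_nodup_append hl.nodup
  have hgp : g ∉ p := fun hp => hd hp hg
  obtain ⟨k, hk, t, ht0, ht⟩ := hf.modular h g (fun e => hgp (e ▸ hh)) h1.symm
  obtain ⟨z, hz⟩ := hf.exists_realizes (hl.biclosed p ⟨q, rfl⟩)
  refine hf.slope_lt_of_mem ht hz hx hh hgp ?_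
  simp only [Set.mem_ofPred_eq, List.mem_append]
  refine ⟨.inl, fun h => h.resolve_right fun hkq => ?_⟩
  have := hle _ hh k hkq
  omega

theorem sorted_unique [Finite ι] (hf : IsFlagged f cls w) {l m : List ι}
    (hl : IsAdmissible f l) (hm : IsAdmissible f m) (hlm : ∀ h, h ∈ l ↔ h ∈ m)
    (hls : l.Pairwise fun h g => cls g ≤ cls h) (hms : m.Pairwise fun h g => cls g ≤ cls h) :
    l = m := by
  obtain ⟨x, hx⟩ := hf.exists_realizes (hl.biclosed l (List.prefix_refl l))
  have hx' : Realizes f x {h | h ∈ m} := by simpa only [hlm] using hx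
  exact ((List.perm_ext_iff_of_nodup hl.nodup hm.nodup).2 hlm).eq_of_pairwise
    (fun _ _ _ _ h1 h2 => (h1.asymm h2).elim)
    (hf.pairwise_before hl hls hx) (hf.pairwise_before hm hms hx')

end IsFlagged

end Forms

/-! ### Pencils at a first ascent and their reversal -/

section Flip

variable {ι : Type*} {V : Type*} [AddCommGroup V] [Module ℝ V]
variable {f : ι → V →ₗ[ℝ] ℝ} {cls : ι → ℕ} {w : ℕ → V}

/-- The form `f h` is a linear combination of `f e` and `f k`. -/
def InPencil (f : ι → V →ₗ[ℝ] ℝ) (e k h : ι) : Prop :=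
  ∃ a b : ℝ, f h = a • f e + b • f k

theorem inPencil_left (f : ι → V →ₗ[ℝ] ℝ) (e k : ι) : InPencil f e k e := ⟨1, 0, by simp⟩

theorem inPencil_right (f : ι → V →ₗ[ℝ] ℝ) (e k : ι) : InPencil f e k k := ⟨0, 1, by simp⟩

theorem InPencil.of_combination {e k h g u : ι} (hg : InPencil f e k g) (hu : InPencil f e k u)
    {a b : ℝ} (H : f h = a • f g + b • f u) : InPencil f e k h := by
  obtain ⟨a1, b1, h1⟩ := hg
  obtain ⟨a2, b2, h2⟩ := hu
  exact ⟨a * a1 + b * a2, a * b1 + b * b2, by rw [H, h1, h2]; module⟩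

namespace IsFlagged

/-- Of the hyperplanes in the pencil of `e` and `k`, with `k` of larger class than `e`, only `k` has
class different from that of `e`. -/
theorem inPencil_spec (hf : IsFlagged f cls w) {e k h : ι} (hek : cls e < cls k) {a b : ℝ}
    (H : f h = a • f e + b • f k) (hne : h ≠ k) :
    cls h = cls e ∧ 0 < a ∧
      ∀ y, slope f cls w h y - slope f cls w e y = b / f h (w (cls h)) * f k y := by
  have H' : ∀ y, f h y = a * f e y + b * f k y := fun y => by simp [H]
  have ha : a ≠ 0 := by
    rintro rfl
    exact hne (hf.eq_of_smul h k b (by rw [H]; simp))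
  have hw : f h (w (cls e)) = a * f e (w (cls e)) := by
    rw [H', hf.apply_of_lt k _ hek]; ring
  have hpe := hf.apply_pos e
  have hc : cls h = cls e := by
    rcases lt_trichotomy (cls h) (cls e) with hlt | heq | hlt
    · have h1 := H' (w (cls h))
      rw [hf.apply_of_lt e _ hlt, hf.apply_of_lt k _ (hlt.trans hek)] at h1
      have := hf.apply_pos h
      simp at h1
      linarith
    · exact heq
    · rw [hf.apply_of_lt h _ hlt] at hw
      exact absurd hw.symm (mul_ne_zero ha hpe.ne')
  have hph := hf.apply_pos h
  refine ⟨hc, ?_, fun y => ?_⟩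
  · rw [hc, hw] at hph
    exact pos_of_mul_pos_left hph hpe.le
  · simp only [slope]
    rw [hc, hw, H' y]
    have := hpe.ne'
    field_simp
    ring

theorem inPencil_of_slope_sub (hf : IsFlagged f cls w) {e k h g : ι} {t : ℝ}
    (ht : ∀ y, slope f cls w h y - slope f cls w g y = t * f k y) (hh : InPencil f e k h) :
    InPencil f e k g := by
  refine hh.of_combination (inPencil_right f e k)
    (a := f g (w (cls g)) / f h (w (cls h))) (b := -(f g (w (cls g)) * t)) ?_
  ext z
  have := ht z
  simp only [LinearMap.add_apply, LinearMap.smul_apply, smul_eq_mul]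
  have e : slope f cls w g z = slope f cls w h z - t * f k z := by linarith
  rw [hf.apply_eq g z, e, slope]
  ring

/-- At a first ascent `e, k` of an admissible list, all other hyperplanes of the pencil have already
been crossed. -/
theorem mem_of_inPencil (hf : IsFlagged f cls w) {Q R : List ι} {e k : ι}
    (hl : IsAdmissible f (Q ++ e :: k :: R)) (hek : cls e < cls k) {h : ι}
    (hh : InPencil f e k h) (hne : h ≠ k) : h ∈ Q ++ [e] := by
  obtain ⟨a, b, H⟩ := hh
  obtain ⟨-, ha, -⟩ := hf.inPencil_spec hek H hne
  have hkQ : k ∉ Q ++ [e] := by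
    have := hl.nodup
    rw [show Q ++ e :: k :: R = (Q ++ [e]) ++ k :: R by simp] at this
    exact fun hk => List.disjoint_of_nodup_append this hk (by simp)
  -- For `b < 0`, `e` is a positive combination of `h` and `k`, so the complement of the prefix
  -- ending in `e` would fail to be closed. For `b > 0`, the prefix ending in `k` is closed and
  -- contains `h`.
  rcases lt_trichotomy b 0 with hb | rfl | hb
  · by_contra hnot
    refine (hl.biclosed (Q ++ [e]) ⟨k :: R, by simp⟩ e h k a⁻¹ (-b / a) (inv_pos.2 ha)
      (div_pos (by linarith) ha) ?_).2 hnot hkQ (by simp)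
    rw [H, smul_add, smul_smul, smul_smul, inv_mul_cancel₀ ha.ne', one_smul, add_assoc, ← add_smul]
    have : a⁻¹ * b + -b / a = 0 := by field_simp; ring
    rw [this]; simp
  · have := hf.eq_of_smul h e a (by rw [H]; simp)
    simp [this]
  · have := (hl.biclosed (Q ++ [e, k]) ⟨R, by simp⟩ h e k a b ha hb H).1 (by simp) (by simp)
    simp only [Set.mem_ofPred_eq, List.mem_append, List.mem_cons, List.not_mem_nil, or_false]
      at this ⊢
    tauto

/-- The hyperplanes of the pencil of a first ascent `e, k` are crossed consecutively. -/
theorem pairwise_inPencil [Finite ι] (hf : IsFlagged f cls w) {Q R : List ι} {e k : ι}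
    (hl : IsAdmissible f (Q ++ e :: k :: R))
    (hQ : (Q ++ [e]).Pairwise fun h g => cls g ≤ cls h) (hek : cls e < cls k) :
    (Q ++ [e]).Pairwise fun h g => InPencil f e k h → InPencil f e k g := by
  rw [List.pairwise_append] at hQ ⊢
  obtain ⟨hQ, -, hQe⟩ := hQ
  refine ⟨pairwise_of_append ?_, by simp, fun _ _ g hg _ => ?_⟩
  swap
  · rw [List.mem_singleton.1 hg]; exact inPencil_left f e k
  rintro p q rfl h hh g hg hhp
  by_contra hgp
  have hnd := hl.nodup
  have hle := (List.pairwise_append.1 hQ).2.2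
  simp only [List.nodup_append, List.nodup_cons, List.mem_append, List.mem_cons] at hnd
  have hhk : h ≠ k := by rintro rfl; exact hnd.2.2 h (.inl hh) h (by simp) rfl
  have hhe : h ≠ e := by rintro rfl; exact hnd.2.2 h (.inl hh) h (by simp) rfl
  have hge : g ≠ e := by rintro rfl; exact hnd.2.2 g (.inr hg) g (by simp) rfl
  have hhg : h ≠ g := hnd.1.2.2 h hh g hg
  have hep : e ∉ p ++ q := fun h => hnd.2.2 e (by simpa using h) e (by simp) rfl
  have hkp : k ∉ p ++ q := fun h => hnd.2.2 k (by simpa using h) k (by simp) rfl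
  have hke : k ≠ e := by rintro rfl; exact hek.ne rfl
  have hgp' : g ∉ p := fun h => hnd.1.2.2 g h g hg rfl
  obtain ⟨a, b, H⟩ := hhp
  obtain ⟨hc, -, hsl⟩ := hf.inPencil_spec hek H hhk
  have hcg : cls g = cls e := by
    have := hle h hh g hg
    have := hQe g (by simp [hg]) e (by simp)
    omega
  obtain ⟨k1, hk1, t1, -, ht1⟩ := hf.modular h g hhg (hc.trans hcg.symm)
  obtain ⟨k2, hk2, t2, -, ht2⟩ := hf.modular g e hge hcg
  have hk1k : k1 ≠ k := by
    rintro rfl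
    exact hgp (hf.inPencil_of_slope_sub ht1 ⟨a, b, H⟩)
  have hk2k : k2 ≠ k := by
    rintro rfl
    refine hgp (hf.inPencil_of_slope_sub (t := -t2) (fun y => ?_) (inPencil_left f e k2))
    have := ht2 y
    linarith
  obtain ⟨zp, hzp⟩ := hf.exists_realizes
    (hl.biclosed p ⟨q ++ e :: k :: R, by simp⟩)
  obtain ⟨zq, hzq⟩ := hf.exists_realizes
    (hl.biclosed (p ++ q) ⟨e :: k :: R, by simp⟩)
  obtain ⟨y, hy⟩ := hf.exists_realizes (hl.biclosed (p ++ q ++ [e]) ⟨k :: R, by simp⟩)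
  obtain ⟨y', hy'⟩ := hf.exists_realizes (hl.biclosed (p ++ q ++ [e, k]) ⟨R, by simp⟩)
  have hk1e : k1 ≠ e := by rintro rfl; omega
  have hk2e : k2 ≠ e := by rintro rfl; omega
  -- Just after `k` is crossed, at `y'`, a form `g` outside the pencil would force the slope of `h`
  -- below that of `g` and that of `g` below that of `e`. Just before, at `y`, the slope of `h` is
  -- below that of `e` as well. But the difference of the slopes of `h` and `e` is a multiple of `f
  -- k`, which changes sign between `y` and `y'`.
  have s1 : slope f cls w h y' < slope f cls w g y' := by
    refine hf.slope_lt_of_mem ht1 hzp hy' hh hgp' ?_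
    have : k1 ∉ q := fun hq => by have := hle h hh k1 hq; omega
    simp [hk1k, hk1e, this]
  have s2 : slope f cls w g y' < slope f cls w e y' := by
    refine hf.slope_lt_of_mem ht2 hzq hy' (by simp [hg]) hep ?_
    simp [hk2k, hk2e]
  have s3 : slope f cls w h y < slope f cls w e y := by
    refine hf.slope_lt_of_mem hsl hzp hy hh (fun h => hep (List.mem_append_left _ h)) ?_
    have : k ∉ p := fun h => hkp (by simp [h])
    have h2 : k ∉ q := fun h => hkp (by simp [h])
    simp [this, h2, hke]
  have r1 := hsl y
  have r2 := hsl y'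
  have p1 : 0 < f k y := hy.pos (by simpa [hke] using hkp)
  have p2 : f k y' < 0 := hy'.neg (by simp)
  have : b / f h (w (cls h)) < 0 := by by_contra! hn; nlinarith
  nlinarith

/-- Reversing a consecutive pencil keeps a list admissible. -/
theorem _root_.Arrangement.IsAdmissible.reverse_pencil {P M R : List ι} {e k : ι}
    (hl : IsAdmissible f (P ++ M ++ R)) (hM : ∀ h, h ∈ M ↔ InPencil f e k h) :
    IsAdmissible f (P ++ M.reverse ++ R) := by
  have hperm : (P ++ M.reverse ++ R).Perm (P ++ M ++ R) :=
    ((List.reverse_perm M).append_left P).append_right R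
  refine ⟨hperm.nodup_iff.2 hl.nodup, fun p hp => ?_⟩
  rw [List.append_assoc] at hp
  rcases prefix_append_cases hp with hp | ⟨s, hs, rfl⟩
  · exact hl.biclosed p (hp.trans ⟨M ++ R, by simp⟩)
  rcases prefix_append_cases hs with hs | ⟨s, hs, rfl⟩
  swap
  · have e : {h | h ∈ P ++ (M.reverse ++ s)} = {h | h ∈ P ++ M ++ s} := by
      ext h; simp
    rw [e]
    exact hl.biclosed _ (by rwa [List.prefix_append_right_inj])
  obtain ⟨M1, hM1⟩ := hs
  have hMs : M = M1.reverse ++ s.reverse := by rw [← List.reverse_append, hM1]; simp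
  have hnd := hl.nodup
  have hP : ∀ h ∈ P, h ∉ M := fun h h1 h2 => by
    rw [List.append_assoc] at hnd
    exact List.disjoint_of_nodup_append hnd h1 (by simp [h2])
  have hs1 : ∀ h ∈ s, h ∉ M1 := fun h h1 h2 => by
    have h3 : M.Nodup := hnd.of_append_left.of_append_right
    rw [hMs] at h3
    exact List.disjoint_of_nodup_append h3 (List.mem_reverse.2 h2) (List.mem_reverse.2 h1)
  have hmem : ∀ h, h ∈ M ↔ h ∈ M1 ∨ h ∈ s := fun h => by rw [hMs]; simp
  have b1 := hl.biclosed P ⟨M ++ R, by simp⟩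
  have b2 := hl.biclosed (P ++ M) ⟨R, by simp⟩
  have b3 := hl.biclosed (P ++ M1.reverse) ⟨s.reverse ++ R, by simp [hMs]⟩
  intro h g u a b ha hb H
  have c1 := b1 h g u a b ha hb H
  have c2 := b2 h g u a b ha hb H
  have c3 := b3 h g u a b ha hb H
  -- A relation among three forms has all of them in the pencil or at most one. With at most one,
  -- the new prefix agrees on the triple with `P` or with `P ++ M`. With all three, it is
  -- complementary on the triple to the old prefix `P ++ M1.reverse`, and biclosedness is symmetric
  -- under complement.
  have m1 : g ∈ M → u ∈ M → h ∈ M := fun h1 h2 =>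
    (hM h).2 (((hM g).1 h1).of_combination ((hM u).1 h2) H)
  have m2 : h ∈ M → u ∈ M → g ∈ M := fun h1 h2 =>
    (hM g).2 (((hM h).1 h1).of_combination ((hM u).1 h2) (a := a⁻¹) (b := -(a⁻¹ * b)) (by
      rw [H, smul_add, smul_smul, inv_mul_cancel₀ ha.ne']; module))
  have m3 : h ∈ M → g ∈ M → u ∈ M := fun h1 h2 =>
    (hM u).2 (((hM h).1 h1).of_combination ((hM g).1 h2) (a := b⁻¹) (b := -(b⁻¹ * a)) (by
      rw [H, smul_add, smul_smul, smul_smul, inv_mul_cancel₀ hb.ne']; module))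
  simp only [Set.mem_ofPred_eq, List.mem_append, List.mem_reverse] at c1 c2 c3 ⊢
  have := hP h
  have := hP g
  have := hP u
  have := hs1 h
  have := hs1 g
  have := hs1 u
  have := hmem h
  have := hmem g
  have := hmem u
  clear b1 b2 b3 hP hs1 hmem hM hM1 hMs hnd hl hp hperm
  by_cases hhM : h ∈ M <;> by_cases hgM : g ∈ M <;> by_cases huM : u ∈ M <;> grind

/-- If the hyperplane `k` is crossed first among its pencil, then the order on
the pencil is determined by the set of crossed hyperplanes. -/
theorem pairwise_filter_pencil [Finite ι] (hf : IsFlagged f cls w) {x : V} {l : List ι}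
    {e k : ι} (hek : cls e < cls k) (hl : IsAdmissible f l) (hx : Realizes f x {h | h ∈ l})
    (hkl : k ∈ l) (hk : l.Pairwise fun h g => g = k → ¬ InPencil f e k h) (p : ι → Bool)
    (hp : ∀ h, p h ↔ InPencil f e k h) :
    (l.filter p).Pairwise fun h g =>
      g ≠ k ∧ (h = k ∨ slope f cls w h x < slope f cls w g x) := by
  rw [List.pairwise_filter]
  refine pairwise_of_append ?_
  rintro q r rfl h hh g hg hhp hgp
  rw [hp] at hhp hgp
  have hk' := (List.pairwise_append.1 hk).2.2
  have hgk : g ≠ k := fun e => hk' h hh g hg e hhp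
  refine ⟨hgk, or_iff_not_imp_left.2 fun hhk => ?_⟩
  have hkq : k ∈ q := (List.mem_append.1 hkl).resolve_right fun hr => hk' h hh k hr rfl hhp
  obtain ⟨a, b, H⟩ := hhp
  obtain ⟨a', b', H'⟩ := hgp
  obtain ⟨-, -, h1⟩ := hf.inPencil_spec hek H hhk
  obtain ⟨-, -, h2⟩ := hf.inPencil_spec hek H' hgk
  obtain ⟨z, hz⟩ := hf.exists_realizes (hl.biclosed q ⟨r, rfl⟩)
  refine hf.slope_lt_of_mem (k := k) (t := b / f h (w (cls h)) - b' / f g (w (cls g)))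
    (fun y => ?_) hz hx hh (fun hgq => List.disjoint_of_nodup_append hl.nodup hgq hg) ?_
  · rw [sub_mul, ← h1, ← h2]; ring
  · simp [hkq]

open Classical in
/-- An admissible list that does not respect the flag contains a consecutive pencil which it crosses
in the order opposite to the one of any admissible list respecting the flag. -/
theorem exists_flip [Finite ι] (hf : IsFlagged f cls w) {l : List ι} (hl : IsAdmissible f l)
    (hs : ¬ l.Pairwise fun h g => cls g ≤ cls h) :
    ∃ P M R e k, l = P ++ M ++ R ∧ e ≠ k ∧ (∀ h, h ∈ M ↔ InPencil f e k h) ∧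
      IsAdmissible f (P ++ M.reverse ++ R) ∧
      ∀ m, IsAdmissible f m → m.Pairwise (fun h g => cls g ≤ cls h) →
        (∀ h, h ∈ m ↔ h ∈ l) → m.filter (fun h => InPencil f e k h) = M.reverse := by
  obtain ⟨Q, e, k, R, rfl, hQ, hek⟩ := exists_first_ascent cls hs
  have hpair := hf.pairwise_inPencil hl hQ hek
  set B := (Q ++ [e]).filter (fun h => InPencil f e k h) with hB
  set P := (Q ++ [e]).filter (fun h => !decide (InPencil f e k h)) with hP
  have hPB : P ++ B = Q ++ [e] := by
    refine filter_not_append_filter _ (hpair.imp fun {a b} h => ?_)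
    simpa using h
  have hkQ : k ∉ Q ++ [e] := by
    have := hl.nodup
    rw [show Q ++ e :: k :: R = (Q ++ [e]) ++ k :: R by simp] at this
    exact fun hk => List.disjoint_of_nodup_append this hk (by simp)
  have hM : ∀ h, h ∈ B ++ [k] ↔ InPencil f e k h := by
    intro h
    rw [List.mem_append, List.mem_singleton, hB, List.mem_filter, decide_eq_true_iff]
    constructor
    · rintro (h | rfl)
      · exact h.2
      · exact inPencil_right f e h
    · intro hh
      by_cases hk : h = k
      · exact .inr hk
      · exact .inl ⟨hf.mem_of_inPencil hl hek hh hk, hh⟩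
  have hsplit : Q ++ e :: k :: R = P ++ (B ++ [k]) ++ R := by
    rw [← List.append_assoc, hPB]; simp
  have hl' := hl
  rw [hsplit] at hl'
  have hadm := hl'.reverse_pencil hM
  refine ⟨P, B ++ [k], R, e, k, hsplit, fun h => hek.ne (by rw [h]), hM, hadm, ?_⟩
  intro m hm hms hml
  obtain ⟨x, hx⟩ := hf.exists_realizes (hm.biclosed m (List.prefix_refl m))
  have hmem : ∀ h, h ∈ P ++ (B ++ [k]).reverse ++ R ↔ h ∈ m := fun h => by
    rw [hml, hsplit]; simp; tauto
  have hx' : Realizes f x {h | h ∈ P ++ (B ++ [k]).reverse ++ R} := by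
    simpa only [hmem] using hx
  have hkm : k ∈ m := by rw [hml]; simp
  have hfilter : (P ++ (B ++ [k]).reverse ++ R).filter (fun h => InPencil f e k h) =
      (B ++ [k]).reverse := by
    have h1 : P.filter (fun h => InPencil f e k h) = [] := by
      rw [List.filter_eq_nil_iff]; intro a ha
      simpa using (List.mem_filter.1 ha).2
    have h2 : R.filter (fun h => InPencil f e k h) = [] := by
      rw [List.filter_eq_nil_iff]; intro a ha
      have := List.disjoint_of_nodup_append hl'.nodup
      have h3 : a ∉ B ++ [k] := fun h => this (List.mem_append_right _ h) ha
      rw [hM] at h3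
      simpa using h3
    have h3 : (B ++ [k]).reverse.filter (fun h => InPencil f e k h) = (B ++ [k]).reverse := by
      rw [List.filter_eq_self]; intro a ha
      simpa using (hM a).1 (List.mem_reverse.1 ha)
    rw [List.filter_append, List.filter_append, h1, h2, h3]; simp
  rw [← hfilter]
  -- Both lists cross `k` first in the pencil, and the slopes at the common endpoint `x` order the
  -- rest: two permutations sorted by one asymmetric relation are equal.
  have hperm : m.Perm (P ++ (B ++ [k]).reverse ++ R) :=
    (List.perm_ext_iff_of_nodup hm.nodup hadm.nodup).2 fun h => (hmem h).symm
  refine (hperm.filter _).eq_of_pairwise ?_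
    (hf.pairwise_filter_pencil hek hm hx hkm ?_ _ fun h => decide_eq_true_iff)
    (hf.pairwise_filter_pencil hek hadm hx' ((hmem k).2 hkm) ?_ _ fun h => decide_eq_true_iff)
  · rintro a b - - ⟨h1, h2⟩ ⟨h3, h4⟩
    exact (lt_asymm (h2.resolve_left h3) (h4.resolve_left h1)).elim
  -- Every other member of the pencil has smaller class than `k`, so a sorted list cannot cross it
  -- before `k`.
  · refine (hms.and hm.nodup).imp ?_
    rintro h g ⟨hle, hne⟩ rfl ⟨a, b, H⟩
    have := (hf.inPencil_spec hek H hne).1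
    omega
  · have hnd := hadm.nodup
    have hPn : ∀ h ∈ P, ¬ InPencil f e k h := fun h hh => by
      simpa using (List.mem_filter.1 hh).2
    rw [List.append_assoc] at hnd ⊢
    have hnd' := hnd.of_append_right
    rw [List.reverse_append, List.reverse_singleton, List.singleton_append, List.cons_append]
      at hnd' ⊢
    have hkn := (List.nodup_cons.1 hnd').1
    rw [List.pairwise_append, List.pairwise_cons]
    refine ⟨List.pairwise_of_forall_mem_list fun h hh g _ _ => hPn h hh,
      ⟨fun g hg hgk => (hkn (hgk ▸ hg)).elim,
        List.pairwise_of_forall_mem_list fun h _ g hg hgk => (hkn (hgk ▸ hg)).elim⟩,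
      fun h hh g _ _ => hPn h hh⟩

end IsFlagged

end Flip

/-! ### Chambers as sets of negative forms -/

section Signs

variable {ι : Type*} {V : Type u} [AddCommGroup V] [Module ℝ V] [TopologicalSpace V]

/-- `A` is the arrangement of the kernels of the continuous linear forms `f i`. -/
structure IsDefinedBy (A : Set (Submodule ℝ V)) (f : ι → V →ₗ[ℝ] ℝ) : Prop where
  continuous : ∀ i, Continuous (f i)
  mem_iff : ∀ H, H ∈ A ↔ ∃ i, LinearMap.ker (f i) = H

/-- The forms that are negative on the chamber `c`. -/
def negForms {A : Set (Submodule ℝ V)} (f : ι → V →ₗ[ℝ] ℝ) (c : Chamber A) : Set ι :=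
  {i | ∃ x ∈ c.1, f i x < 0}

variable {A : Set (Submodule ℝ V)} {f : ι → V →ₗ[ℝ] ℝ}

theorem Chamber.subset_complement (c : Chamber A) : c.1 ⊆ complement A := by
  obtain ⟨x, -, hc⟩ := c.2
  rw [hc]
  exact connectedComponentIn_subset _ _

theorem Chamber.eq_connectedComponentIn (c : Chamber A) {x : V} (hx : x ∈ c.1) :
    c.1 = connectedComponentIn (complement A) x := by
  obtain ⟨y, -, hc⟩ := c.2
  rw [hc] at hx ⊢
  exact connectedComponentIn_eq hx

theorem Chamber.isPreconnected (c : Chamber A) : IsPreconnected c.1 := by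
  obtain ⟨x, -, hc⟩ := c.2
  rw [hc]
  exact isPreconnected_connectedComponentIn

namespace IsDefinedBy

theorem mem_complement (hA : IsDefinedBy A f) {x : V} :
    x ∈ complement A ↔ ∀ i, f i x ≠ 0 := by
  constructor
  · intro h i hi
    exact h _ ((hA.mem_iff _).2 ⟨i, rfl⟩) hi
  · rintro h H hH hx
    obtain ⟨i, rfl⟩ := (hA.mem_iff H).1 hH
    exact h i hx

theorem ne_zero (hA : IsDefinedBy A f) {c : Chamber A} {x : V} (hx : x ∈ c.1) (i : ι) :
    f i x ≠ 0 :=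
  hA.mem_complement.1 (c.subset_complement hx) i

theorem neg_iff (hA : IsDefinedBy A f) {c : Chamber A} {x : V} (hx : x ∈ c.1) (i : ι) :
    f i x < 0 ↔ i ∈ negForms f c := by
  refine ⟨fun h => ⟨x, hx, h⟩, ?_⟩
  rintro ⟨y, hy, hn⟩
  by_contra! h
  obtain ⟨z, hz, h0⟩ := c.isPreconnected.intermediate_value hy hx (hA.continuous i).continuousOn
    (show (0 : ℝ) ∈ Set.Icc (f i y) (f i x) from ⟨hn.le, h⟩)
  exact hA.ne_zero hz i h0

theorem realizes (hA : IsDefinedBy A f) {c : Chamber A} {x : V} (hx : x ∈ c.1) :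
    Realizes f x (negForms f c) := fun i => ⟨hA.ne_zero hx i, hA.neg_iff hx i⟩

theorem exists_chamber (hA : IsDefinedBy A f) {x : V} {T : Set ι} (hx : Realizes f x T) :
    ∃ c : Chamber A, negForms f c = T := by
  have hc : x ∈ complement A := hA.mem_complement.2 fun i => (hx i).1
  let c : Chamber A := ⟨connectedComponentIn (complement A) x, x, hc, rfl⟩
  have hxc : x ∈ c.1 := mem_connectedComponentIn hc
  refine ⟨c, ?_⟩
  ext i
  rw [← hA.neg_iff hxc, (hx i).2]

/-- The segment between two points with equal signs avoids every hyperplane. -/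
theorem negForms_injective [IsTopologicalAddGroup V] [ContinuousSMul ℝ V]
    (hA : IsDefinedBy A f) : Function.Injective (negForms f : Chamber A → Set ι) := by
  intro c c' h
  obtain ⟨x, hx⟩ := c.nonempty
  obtain ⟨y, hy⟩ := c'.nonempty
  refine Subtype.ext ?_
  rw [c.eq_connectedComponentIn hx, c'.eq_connectedComponentIn hy]
  apply connectedComponentIn_eq
  have rx := hA.realizes hx
  have ry := hA.realizes hy
  rw [← h] at ry
  refine (convex_segment x y).isPreconnected.subset_connectedComponentIn (left_mem_segment ℝ x y)
    ?_ (right_mem_segment ℝ x y)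
  rintro z ⟨a, b, ha, hb, hab, rfl⟩
  rw [hA.mem_complement]
  intro i
  simp only [map_add, map_smul, smul_eq_mul]
  by_cases hi : i ∈ negForms f c
  · have h1 := rx.neg hi
    have h2 := ry.neg hi
    refine (show a * f i x + b * f i y < 0 from ?_).ne
    rcases ha.eq_or_lt with rfl | ha
    · nlinarith
    · nlinarith
  · have h1 := rx.pos hi
    have h2 := ry.pos hi
    refine (show 0 < a * f i x + b * f i y from ?_).ne'
    rcases ha.eq_or_lt with rfl | ha
    · nlinarith
    · nlinarith

theorem separates_iff (hA : IsDefinedBy A f) (c c' : Chamber A) (i : ι) :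
    Separates (LinearMap.ker (f i)) c.1 c'.1 ↔ i ∈ symmDiff (negForms f c) (negForms f c') := by
  rw [Set.mem_symmDiff]
  constructor
  · rintro ⟨g, hg, h1, h2⟩
    obtain ⟨x, hx⟩ := c.nonempty
    obtain ⟨y, hy⟩ := c'.nonempty
    have h1 := h1 x hx
    have h2 := h2 y hy
    -- The separating form `g` shares only its kernel with `f i`; this kernel vector transfers the
    -- opposite signs of `g` to `f i`.
    have hz : g x • y - g y • x ∈ LinearMap.ker g := by
      simp only [LinearMap.mem_ker, map_sub, map_smul, smul_eq_mul]; ring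
    rw [hg] at hz
    simp only [LinearMap.mem_ker, map_sub, map_smul, smul_eq_mul] at hz
    have rx := hA.realizes hx
    have ry := hA.realizes hy
    by_cases hi : i ∈ negForms f c <;> by_cases hi' : i ∈ negForms f c'
    · nlinarith [rx.neg hi, ry.neg hi']
    · exact .inl ⟨hi, hi'⟩
    · exact .inr ⟨hi', hi⟩
    · nlinarith [rx.pos hi, ry.pos hi']
  · rintro (⟨h1, h2⟩ | ⟨h1, h2⟩)
    · refine ⟨-f i, by ext; simp, fun x hx => ?_, fun x hx => ?_⟩
      · simpa using (hA.realizes hx).neg h1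
      · simpa using (hA.realizes hx).pos h2
    · exact ⟨f i, rfl, fun x hx => (hA.realizes hx).pos h2, fun x hx => (hA.realizes hx).neg h1⟩

theorem sepHyperplanes_eq (hA : IsDefinedBy A f) (c c' : Chamber A) :
    sepHyperplanes A c c' =
      (fun i => LinearMap.ker (f i)) '' symmDiff (negForms f c) (negForms f c') := by
  ext H
  constructor
  · rintro ⟨h1, h2⟩
    obtain ⟨i, rfl⟩ := (hA.mem_iff H).1 h1
    exact ⟨i, (hA.separates_iff c c' i).1 h2, rfl⟩
  · rintro ⟨i, hi, rfl⟩
    exact ⟨(hA.mem_iff _).2 ⟨i, rfl⟩, (hA.separates_iff c c' i).2 hi⟩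

theorem adj_iff (hA : IsDefinedBy A f) (hinj : Function.Injective fun i => LinearMap.ker (f i))
    (c c' : Chamber A) :
    (chamberGraph A).Adj c c' ↔ ∃ i, symmDiff (negForms f c) (negForms f c') = {i} := by
  rw [← Set.encard_eq_one, ← hinj.encard_image, ← hA.sepHyperplanes_eq]
  rfl

/-- The forms vanishing on `Y` define the localization at `Y`. -/
theorem localization (hA : IsDefinedBy A f) (Y : Submodule ℝ V) :
    IsDefinedBy (localization A Y)
      (fun i : {i // Y ≤ LinearMap.ker (f i)} => Y.liftQ (f i.1) i.2) := by
  refine ⟨fun i => ?_, fun K => ?_⟩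
  · exact (hA.continuous i.1).quotient_lift _
  · constructor
    · rintro ⟨H, hH, hY, rfl⟩
      obtain ⟨i, rfl⟩ := (hA.mem_iff H).1 hH
      exact ⟨⟨i, hY⟩, Submodule.ker_liftQ _ _ _⟩
    · rintro ⟨i, rfl⟩
      exact ⟨_, (hA.mem_iff _).2 ⟨i.1, rfl⟩, i.2, Submodule.ker_liftQ _ _ _⟩

theorem negForms_quot (hA : IsDefinedBy A f) (Y : Submodule ℝ V) (c : Chamber A) :
    Subtype.val '' negForms (fun i : {i // Y ≤ LinearMap.ker (f i)} => Y.liftQ (f i.1) i.2)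
      (c.quot Y) = {i | i ∈ negForms f c ∧ Y ≤ LinearMap.ker (f i)} := by
  obtain ⟨x, hx⟩ := c.nonempty
  have hxq : Y.mkQ x ∈ (c.quot Y).1 :=
    ⟨x, hx, mem_connectedComponentIn (mk_mem_complement Y (c.subset_complement hx))⟩
  ext i
  constructor
  · rintro ⟨j, hj, rfl⟩
    rw [← (hA.localization Y).neg_iff hxq] at hj
    exact ⟨(hA.neg_iff hx _).1 (by simpa using hj), j.2⟩
  · rintro ⟨h1, h2⟩
    refine ⟨⟨i, h2⟩, ?_, rfl⟩
    rw [← (hA.localization Y).neg_iff hxq]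
    simpa using (hA.neg_iff hx _).2 h1

end IsDefinedBy

end Signs

/-! ### Walks whose labels grow by one element per step -/

section Walks

variable {C ι : Type*} {G : SimpleGraph C} {inv : C → Set ι}

/-- The walk `p` adds the elements of `l` one after the other to the label of its start. -/
def IsCode (inv : C → Set ι) {b c : C} (p : G.Walk b c) (l : List ι) : Prop :=
  p.support.map inv = l.inits.map fun q => inv b ∪ {h | h ∈ q}

theorem ncard_symmDiff_le_length [Finite ι]
    (hG : ∀ b c, G.Adj b c → ∃ h, symmDiff (inv b) (inv c) = {h}) {b c : C} (p : G.Walk b c) :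
    (symmDiff (inv b) (inv c)).ncard ≤ p.length := by
  induction p with
  | nil => simp
  | @cons b b' c hadj p ih =>
    obtain ⟨h, hh⟩ := hG _ _ hadj
    have h1 := Set.ncard_le_ncard (symmDiff_triangle (inv b) (inv b') (inv c))
      (Set.toFinite _)
    have h2 := Set.ncard_union_le (symmDiff (inv b) (inv b')) (symmDiff (inv b') (inv c))
    rw [hh, Set.ncard_singleton] at h2
    rw [SimpleGraph.Walk.length_cons]
    rw [hh] at h1
    simp only [Set.sup_eq_union] at h1
    omega

/-- A step changes the label by one element, so a walk no longer than the label difference can waste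
none: each step adds an element of the final label. -/
theorem exists_isCode [Finite ι]
    (hG : ∀ b c, G.Adj b c → ∃ h, symmDiff (inv b) (inv c) = {h}) {b c : C} (p : G.Walk b c)
    (hsub : inv b ⊆ inv c) (hlen : p.length = (inv c \ inv b).ncard) :
    ∃ l : List ι, l.Nodup ∧ (∀ h ∈ l, h ∉ inv b) ∧ inv c = inv b ∪ {h | h ∈ l} ∧
      IsCode inv p l := by
  induction p with
  | nil => exact ⟨[], by simp, by simp, by simp, by simp [IsCode]⟩
  | @cons b b' c hadj p ih =>
    obtain ⟨h, hh⟩ := hG _ _ hadj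
    have hle := ncard_symmDiff_le_length hG p
    rw [SimpleGraph.Walk.length_cons] at hlen
    have hmem : ∀ g, (g ∈ inv b ∧ g ∉ inv b' ∨ g ∈ inv b' ∧ g ∉ inv b) ↔ g = h := fun g => by
      rw [← Set.mem_symmDiff, hh, Set.mem_singleton_iff]
    -- Otherwise the remaining walk would be shorter than the label change it has to make.
    have hlarge : ¬ (inv c \ inv b ⊆ symmDiff (inv b') (inv c)) := fun hs => by
      have := Set.ncard_le_ncard hs (Set.toFinite _)
      omega
    have hb : h ∉ inv b := fun hb => hlarge fun g hg => by
      have := hmem g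
      have := hmem h
      rw [Set.mem_symmDiff]
      grind
    have hb' : h ∈ inv b' := by
      have := hmem h
      tauto
    have hc : h ∈ inv c := by
      by_contra hc
      refine hlarge fun g hg => ?_
      have := hmem g
      rw [Set.mem_symmDiff]
      grind
    have hins : inv b' = insert h (inv b) := by
      ext g
      have := hmem g
      rw [Set.mem_insert_iff]
      grind
    have hsub' : inv b' ⊆ inv c := by
      rw [hins]; exact Set.insert_subset hc hsub
    have hcard : p.length = (inv c \ inv b').ncard := by
      have e : inv c \ inv b = insert h (inv c \ inv b') := by
        ext g
        simp only [hins, Set.mem_sdiff, Set.mem_insert_iff]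
        grind
      rw [e, Set.ncard_insert_of_notMem (by simp [hb']) (Set.toFinite _)] at hlen
      omega
    obtain ⟨l, hnd, hdis, hun, hcode⟩ := ih hsub' hcard
    have key : ∀ q : List ι, inv b' ∪ {g | g ∈ q} = inv b ∪ {g | g ∈ h :: q} := fun q => by
      ext g
      simp only [hins, Set.mem_union, Set.mem_insert_iff, Set.mem_ofPred_eq, List.mem_cons]
      tauto
    refine ⟨h :: l, List.nodup_cons.2 ⟨fun hl => hdis h hl hb', hnd⟩, ?_, hun.trans (key l), ?_⟩
    · rintro g hg
      rcases List.mem_cons.1 hg with rfl | hg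
      · exact hb
      · exact fun h => hdis g hg (by rw [hins]; exact Set.mem_insert_of_mem _ h)
    · rw [IsCode] at hcode ⊢
      rw [SimpleGraph.Walk.support_cons, List.map_cons, hcode, List.inits, List.map_cons,
        List.map_map]
      congr 1
      · simp
      · exact List.map_congr_left fun q _ => key q

theorem exists_walk_of_isCode
    (hG : ∀ b c, (∃ h, symmDiff (inv b) (inv c) = {h}) → G.Adj b c) (l : List ι) (b : C)
    (hnd : l.Nodup) (hdis : ∀ h ∈ l, h ∉ inv b)
    (hpre : ∀ q, q <+: l → ∃ c, inv c = inv b ∪ {h | h ∈ q}) :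
    ∃ c, ∃ p : G.Walk b c, inv c = inv b ∪ {h | h ∈ l} ∧ p.length = l.length ∧
      IsCode inv p l := by
  induction l generalizing b with
  | nil => exact ⟨b, .nil, by simp, rfl, by simp [IsCode]⟩
  | cons h l ih =>
    obtain ⟨b', hb'⟩ := hpre [h] ⟨l, rfl⟩
    have hb : h ∉ inv b := hdis h (by simp)
    have key : ∀ q : List ι, inv b' ∪ {g | g ∈ q} = inv b ∪ {g | g ∈ h :: q} := fun q => by
      ext g
      simp only [hb', Set.mem_union, Set.mem_ofPred_eq, List.mem_cons, List.not_mem_nil]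
      tauto
    have hadj : G.Adj b b' := by
      refine hG b b' ⟨h, ?_⟩
      ext g
      simp only [hb', Set.mem_symmDiff, Set.mem_union, Set.mem_ofPred_eq, List.mem_singleton,
        Set.mem_singleton_iff]
      grind
    rw [List.nodup_cons] at hnd
    obtain ⟨c, p, h1, h2, h3⟩ := ih b' hnd.2
      (fun g hg hgb => by
        rw [hb'] at hgb
        rcases hgb with hgb | hgb
        · exact hdis g (by simp [hg]) hgb
        · rw [Set.mem_ofPred_eq, List.mem_singleton] at hgb
          exact hnd.1 (hgb ▸ hg))
      (fun q hq => by
        rw [key]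
        exact hpre (h :: q) (List.cons_prefix_cons.2 ⟨rfl, hq⟩))
    refine ⟨c, .cons hadj p, h1.trans (key l), by simp [h2], ?_⟩
    rw [IsCode] at h3 ⊢
    rw [SimpleGraph.Walk.support_cons, List.map_cons, h3, List.inits, List.map_cons,
        List.map_map]
    congr 1
    · simp
    · exact List.map_congr_left fun q _ => key q

theorem IsCode.walk_eq (hinj : Function.Injective inv) {b c : C} {p q : G.Walk b c} {l : List ι}
    (hp : IsCode inv p l) (hq : IsCode inv q l) : p = q :=
  SimpleGraph.Walk.ext_support (hinj.list_map (hp.trans hq.symm))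

theorem IsCode.getVert {b c : C} {p : G.Walk b c} {l : List ι} (hp : IsCode inv p l) {n : ℕ}
    (hn : n ≤ l.length) : inv (p.getVert n) = inv b ∪ {h | h ∈ l.take n} := by
  have hlen : p.length = l.length := by
    have := congrArg List.length hp
    simpa using this
  have h1 : (p.support.map inv)[n]? = some (inv (p.getVert n)) := by
    rw [List.getElem?_map, ← p.getVert_eq_support_getElem? (by omega)]
    rfl
  have h2 : (l.inits.map fun q => inv b ∪ {h | h ∈ q})[n]? =
      some (inv b ∪ {h | h ∈ l.take n}) := by
    rw [List.getElem?_map]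
    simp [hn]
  rw [hp, h2] at h1
  exact (Option.some.inj h1).symm

end Walks

/-! ### Deleting repetitions from filtered prefixes -/

section Destutter

variable {ι : Type*}

theorem eq_of_prefix_of_mem_iff {l p q : List ι} (hl : l.Nodup) (hp : p <+: l) (hq : q <+: l)
    (h : ∀ a, a ∈ p ↔ a ∈ q) : p = q := by
  have hlen : p.length = q.length :=
    ((List.perm_ext_iff_of_nodup (hl.sublist hp.sublist) (hl.sublist hq.sublist)).2 h).length_eq
  exact (List.prefix_of_prefix_length_le hp hq hlen.le).eq_of_length hlen

open Classical in
-- An element outside `P` repeats the previous filtered prefix, and one inside `P` extends it;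
-- deleting repetitions leaves each prefix of the filtered list once.
theorem destutter_map_filter_inits (P : ι → Bool) (l : List ι) :
    (l.inits.map (List.filter P)).destutter (· ≠ ·) = (l.filter P).inits := by
  induction l with
  | nil => simp
  | cons a l ih =>
    obtain ⟨t, ht⟩ : ∃ t, l.inits = [] :: t := by cases l <;> exact ⟨_, rfl⟩
    by_cases ha : P a
    · have e : (List.inits (a :: l)).map (List.filter P) =
          [] :: (l.inits.map (List.filter P)).map (List.cons a) := by
        simp [List.inits, ha, Function.comp_def]
      have e' := List.map_destutter (R := (· ≠ ·)) (R₂ := (· ≠ ·)) (f := List.cons a)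
        (l := l.inits.map (List.filter P)) fun _ _ _ _ => List.cons_injective.ne_iff.symm
      rw [e, List.filter_cons_of_pos ha, List.inits, ← ih]
      change _ = [] :: List.map (List.cons a) _
      rw [e']
      simp [ht, List.destutter]
    · have e : (List.inits (a :: l)).map (List.filter P) =
          [] :: (l.inits.map (List.filter P)) := by
        simp [List.inits, ha, Function.comp_def]
      rw [e, List.filter_cons_of_neg ha, ← ih]
      simp [ht, List.destutter]

end Destutter

/-! ### Minimal galleries as admissible lists -/

section Galleries

variable {ι : Type*} {V : Type u} [AddCommGroup V] [Module ℝ V] [TopologicalSpace V]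
  {A : Set (Submodule ℝ V)} {f : ι → V →ₗ[ℝ] ℝ} {cls : ι → ℕ} {w : ℕ → V} {c₀ c : Chamber A}

theorem MinimalGallery.crossesAt_iff (hA : IsDefinedBy A f) {r : MinimalGallery A c₀ c}
    {l : List ι} (hnd : l.Nodup) (h₀ : negForms f c₀ = ∅) (hr : IsCode (negForms f) r.1 l)
    (n : ℕ) (H : Submodule ℝ V) :
    r.CrossesAt n H ↔ ∃ hn : n < l.length, LinearMap.ker (f l[n]) = H := by
  have hlen : r.1.length = l.length := by
    have := congrArg List.length hr
    simpa using this
  have key : ∀ hn : n < l.length,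
      symmDiff (negForms f (r.1.getVert n)) (negForms f (r.1.getVert (n + 1))) = {l[n]} := by
    intro hn
    rw [hr.getVert hn.le, hr.getVert hn, h₀, Set.empty_union, Set.empty_union,
      List.take_succ_eq_append_getElem hn]
    have hnot : l[n] ∉ l.take n := fun h => by
      have := hnd.sublist (List.take_sublist (n + 1) l)
      rw [List.take_succ_eq_append_getElem hn] at this
      exact List.disjoint_of_nodup_append this h (by simp)
    ext h
    simp only [Set.mem_symmDiff, Set.mem_ofPred_eq, List.mem_append, List.mem_singleton,
      Set.mem_singleton_iff]
    grind
  rw [MinimalGallery.CrossesAt, hlen, hA.sepHyperplanes_eq]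
  constructor
  · rintro ⟨hn, i, hi, rfl⟩
    rw [key hn] at hi
    exact ⟨hn, by rw [Set.mem_singleton_iff.1 hi]⟩
  · rintro ⟨hn, rfl⟩
    exact ⟨hn, l[n], by rw [key hn]; rfl, rfl⟩

theorem MinimalGallery.incidentToFlag_iff (hA : IsDefinedBy A f) {r : MinimalGallery A c₀ c}
    {l : List ι} (hnd : l.Nodup) (h₀ : negForms f c₀ = ∅) (hr : IsCode (negForms f) r.1 l)
    {d : ℕ} {X : Fin (d + 1) → Submodule ℝ V}
    (hX : ∀ (j : Fin (d + 1)) i, X j ≤ LinearMap.ker (f i) ↔ (j : ℕ) ≤ cls i)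
    (hcls : ∀ i, cls i ≤ d) :
    r.IncidentToFlag X ↔ l.Pairwise fun h g => cls g ≤ cls h := by
  have hc := r.crossesAt_iff hA hnd h₀ hr
  constructor
  · intro h
    rw [List.pairwise_iff_getElem]
    intro a b ha hb hab
    by_contra! hlt
    -- Index 0 imposes nothing on the second hyperplane, and the class of the later form is the
    -- largest index allowed for the first.
    have := h 0 ⟨cls l[b], Nat.lt_succ_of_le (hcls _)⟩ (Fin.lt_def.2 (by simp; omega))
      _ ((hA.mem_iff _).2 ⟨l[b], rfl⟩) _ ((hA.mem_iff _).2 ⟨l[a], rfl⟩)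
      ((hX _ _).2 le_rfl) ((hX _ _).2 (by simp)) (by rw [hX]; simpa using hlt)
      b a ((hc _ _).2 ⟨hb, rfl⟩) ((hc _ _).2 ⟨ha, rfl⟩)
    omega
  · intro h i j hij H _ H' _ h1 h2 h3 a b hca hcb
    obtain ⟨ha, rfl⟩ := (hc _ _).1 hca
    obtain ⟨hb, rfl⟩ := (hc _ _).1 hcb
    rw [hX] at h1 h3
    rcases lt_trichotomy a b with hab | rfl | hab
    · exact hab
    · omega
    · have := List.pairwise_iff_getElem.1 h b a hb ha hab
      omega

open Classical in
theorem MinimalGallery.map_quot {Y : Submodule ℝ V}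
    {g : Chamber (localization A Y) → Set ι} (hg : Function.Injective g)
    (hgq : ∀ b : Chamber A, g (b.quot Y) = {i | i ∈ negForms f b ∧ Y ≤ LinearMap.ker (f i)})
    {r : MinimalGallery A c₀ c} {l : List ι} (hnd : l.Nodup) (h₀ : negForms f c₀ = ∅)
    (hr : IsCode (negForms f) r.1 l) :
    (r.quot Y).map g =
      (l.filter fun i => Y ≤ LinearMap.ker (f i)).inits.map fun q => {i | i ∈ q} := by
  rw [MinimalGallery.quot, List.map_destutter (f := g) (R := (· ≠ ·)) (R₂ := (· ≠ ·))
    (fun _ _ _ _ => hg.ne_iff.symm), ← destutter_map_filter_inits,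
    List.map_destutter (R₂ := (· ≠ ·))]
  · congr 1
    have e : (r.1.support.map fun b => b.quot Y).map g =
        (r.1.support.map (negForms f)).map fun S => {i | i ∈ S ∧ Y ≤ LinearMap.ker (f i)} := by
      rw [List.map_map, List.map_map]
      exact List.map_congr_left fun b _ => hgq b
    rw [e, hr, List.map_map, List.map_map]
    refine List.map_congr_left fun q _ => ?_
    ext i
    simp [h₀]
  -- Chambers are compared through sets, destuttering here through lists; prefixes of a
  -- duplicate-free list with the same elements coincide.
  · intro a ha b hb
    obtain ⟨p, hp, rfl⟩ := List.mem_map.1 ha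
    obtain ⟨q, hq, rfl⟩ := List.mem_map.1 hb
    rw [List.mem_inits] at hp hq
    refine not_congr ⟨fun h => by rw [h], fun h => ?_⟩
    exact eq_of_prefix_of_mem_iff (hnd.filter _) (hp.filter _) (hq.filter _)
      fun i => Set.ext_iff.1 h i

variable [IsTopologicalAddGroup V] [ContinuousSMul ℝ V]

open Classical in
theorem MinimalGallery.quot_eq_of_filter_eq (hA : IsDefinedBy A f) (Y : Submodule ℝ V)
    (h₀ : negForms f c₀ = ∅) {r r' : MinimalGallery A c₀ c} {l l' : List ι} (hl : l.Nodup)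
    (hl' : l'.Nodup) (hr : IsCode (negForms f) r.1 l) (hr' : IsCode (negForms f) r'.1 l')
    (h : l.filter (fun i => Y ≤ LinearMap.ker (f i)) =
      l'.filter fun i => Y ≤ LinearMap.ker (f i)) : r.quot Y = r'.quot Y := by
  have hg := Subtype.val_injective.image_injective.comp (hA.localization Y).negForms_injective
  apply hg.list_map
  rw [MinimalGallery.map_quot hg (hA.negForms_quot Y) hl h₀ hr,
    MinimalGallery.map_quot hg (hA.negForms_quot Y) hl' h₀ hr', h]

open Classical in
theorem MinimalGallery.head_eq_of_quot_eq (hA : IsDefinedBy A f) (Y : Submodule ℝ V)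
    (h₀ : negForms f c₀ = ∅) {r r' : MinimalGallery A c₀ c} {l l' : List ι} (hl : l.Nodup)
    (hl' : l'.Nodup) (hr : IsCode (negForms f) r.1 l) (hr' : IsCode (negForms f) r'.1 l')
    (h : r.quot Y = r'.quot Y) {a a' : ι} {m m' : List ι}
    (hm : l.filter (fun i => Y ≤ LinearMap.ker (f i)) = a :: m)
    (hm' : l'.filter (fun i => Y ≤ LinearMap.ker (f i)) = a' :: m') : a = a' := by
  have hg := Subtype.val_injective.image_injective.comp (hA.localization Y).negForms_injective
  have e1 := MinimalGallery.map_quot hg (hA.negForms_quot Y) hl h₀ hr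
  have e2 := MinimalGallery.map_quot hg (hA.negForms_quot Y) hl' h₀ hr'
  rw [h, e2, hm, hm'] at e1
  -- Entry 1 is the first nonempty prefix, that is, the singleton of the first form crossed.
  have e3 := congrArg (fun L => L[1]?) e1
  simp only [List.getElem?_map] at e3
  have e4 : ∀ (b : ι) (n : List ι), (b :: n).inits[1]? = some [b] := by
    intro b n; cases n <;> simp [List.inits]
  rw [e4, e4] at e3
  have e5 := Set.ext_iff.1 (Option.some.inj e3) a
  simpa using e5

variable [Finite ι]

theorem IsAdmissible.exists_walk (hA : IsDefinedBy A f)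
    (hinj : Function.Injective fun i => LinearMap.ker (f i)) (hf : IsFlagged f cls w)
    (h₀ : negForms f c₀ = ∅) {l : List ι} (hl : IsAdmissible f l)
    (hlc : ∀ h, h ∈ l ↔ h ∈ negForms f c) :
    ∃ p : (chamberGraph A).Walk c₀ c, p.length = l.length ∧ IsCode (negForms f) p l := by
  obtain ⟨c', p, h1, h2, h3⟩ := exists_walk_of_isCode (G := chamberGraph A) (inv := negForms f)
    (fun b c => (hA.adj_iff hinj b c).2) l c₀ hl.nodup (by simp [h₀]) (fun q hq => by
      obtain ⟨y, hy⟩ := hf.exists_realizes (hl.biclosed q hq)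
      obtain ⟨b, hb⟩ := hA.exists_chamber hy
      exact ⟨b, by rw [hb, h₀, Set.empty_union]⟩)
  have : c' = c := hA.negForms_injective (by
    rw [h1, h₀, Set.empty_union]; ext h; exact hlc h)
  subst this
  exact ⟨p, h2, h3⟩

/-- The sorted list gives a gallery of this length; no walk is shorter, since each step changes one
sign. -/
theorem dist_eq_ncard (hA : IsDefinedBy A f)
    (hinj : Function.Injective fun i => LinearMap.ker (f i)) (hf : IsFlagged f cls w)
    (h₀ : negForms f c₀ = ∅) (c : Chamber A) :
    (chamberGraph A).dist c₀ c = (negForms f c).ncard := by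
  classical
  obtain ⟨x, hx⟩ := c.nonempty
  obtain ⟨l, hl, -, hlc⟩ := hf.exists_sorted (hA.realizes hx)
  obtain ⟨p, hp, -⟩ := hl.exists_walk hA hinj hf h₀ hlc
  have hcard : (negForms f c).ncard = l.length := by
    have : negForms f c = (l.toFinset : Set ι) := by ext h; simp [hlc]
    rw [this, Set.ncard_coe_finset, List.toFinset_card_of_nodup hl.nodup]
  apply le_antisymm
  · rw [hcard, ← hp]
    exact SimpleGraph.dist_le p
  · obtain ⟨q, hq⟩ := p.reachable.exists_walk_length_eq_dist
    rw [← hq]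
    have := ncard_symmDiff_le_length (inv := negForms f)
      (fun b c => (hA.adj_iff hinj b c).1) q
    rwa [h₀, ← Set.bot_eq_empty, bot_symmDiff] at this

theorem MinimalGallery.exists_isCode (hA : IsDefinedBy A f)
    (hinj : Function.Injective fun i => LinearMap.ker (f i)) (hf : IsFlagged f cls w)
    (h₀ : negForms f c₀ = ∅) (r : MinimalGallery A c₀ c) :
    ∃ l, IsAdmissible f l ∧ (∀ h, h ∈ l ↔ h ∈ negForms f c) ∧ IsCode (negForms f) r.1 l := by
  obtain ⟨l, hnd, -, hun, hcode⟩ := Arrangement.exists_isCode (inv := negForms f)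
    (fun b c => (hA.adj_iff hinj b c).1) r.1 (by simp [h₀])
    (by rw [r.2, dist_eq_ncard hA hinj hf h₀, h₀, Set.sdiff_empty])
  refine ⟨l, ⟨hnd, fun q hq => ?_⟩, fun h => by rw [hun, h₀]; simp, hcode⟩
  have := hcode.getVert hq.length_le
  rw [← List.prefix_iff_eq_take.1 hq, h₀, Set.empty_union] at this
  obtain ⟨x, hx⟩ := (r.1.getVert q.length).nonempty
  rw [← this]
  exact (hA.realizes hx).isBiclosed

theorem IsAdmissible.exists_minimalGallery (hA : IsDefinedBy A f)
    (hinj : Function.Injective fun i => LinearMap.ker (f i)) (hf : IsFlagged f cls w)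
    (h₀ : negForms f c₀ = ∅) {l : List ι} (hl : IsAdmissible f l)
    (hlc : ∀ h, h ∈ l ↔ h ∈ negForms f c) :
    ∃ r : MinimalGallery A c₀ c, IsCode (negForms f) r.1 l := by
  classical
  obtain ⟨p, hp, hc⟩ := hl.exists_walk hA hinj hf h₀ hlc
  refine ⟨⟨p, ?_⟩, hc⟩
  have : negForms f c = (l.toFinset : Set ι) := by ext h; simp [hlc]
  rw [hp, dist_eq_ncard hA hinj hf h₀, this, Set.ncard_coe_finset,
    List.toFinset_card_of_nodup hl.nodup]

end Galleries

/-! ### Descent in the graph of minimal galleries -/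

section Descent

theorem reverse_eq_self_of_subsingleton {α : Type*} {l : List α} (hl : l.Nodup)
    (h : ∀ a ∈ l, ∀ b ∈ l, a = b) : l.reverse = l := by
  match l with
  | [] => rfl
  | [a] => rfl
  | a :: b :: t =>
    have := h a (by simp) b (by simp)
    simp [this] at hl

theorem head_ne_head_reverse {α : Type*} {l : List α} (hl : l.Nodup) {e k a b : α} {s t : List α}
    (he : e ∈ l) (hk : k ∈ l) (hek : e ≠ k) (h1 : l = a :: s) (h2 : l.reverse = b :: t) :
    a ≠ b := by
  rintro rfl
  have h3 : l = t.reverse ++ [a] := by rw [← List.reverse_reverse l, h2]; simp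
  rcases ht : t.reverse with _ | ⟨x, u⟩
  · rw [h3, ht] at he hk
    simp at he hk
    exact hek (he.trans hk.symm)
  · rw [ht, List.cons_append] at h3
    rw [h3] at hl h1
    have : x = a := (List.cons.inj h1).1
    subst this
    simp at hl

variable {ι : Type*} {V : Type u} [AddCommGroup V] [Module ℝ V]

theorem inPencil_iff_le_ker {f : ι → V →ₗ[ℝ] ℝ} {e k h : ι} :
    InPencil f e k h ↔ LinearMap.ker (f e) ⊓ LinearMap.ker (f k) ≤ LinearMap.ker (f h) := by
  constructor
  · rintro ⟨a, b, H⟩ x ⟨h1, h2⟩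
    rw [LinearMap.mem_ker] at *
    simp only [SetLike.mem_coe, LinearMap.mem_ker] at h1 h2
    simp [H, h1, h2]
  · intro H
    have := mem_span_of_iInf_ker_le_ker (L := ![f e, f k]) (K := f h) (by
      refine le_trans ?_ H
      exact le_inf (iInf_le (fun i => LinearMap.ker (![f e, f k] i)) 0)
        (iInf_le (fun i => LinearMap.ker (![f e, f k] i)) 1))
    rw [Matrix.range_cons, Matrix.range_cons, Matrix.range_empty, Set.union_empty,
      Set.singleton_union, Submodule.mem_span_pair] at this
    obtain ⟨a, b, hab⟩ := this
    exact ⟨a, b, hab.symm⟩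

theorem finrank_inf_of_ne [FiniteDimensional ℝ V] {H K : Submodule ℝ V}
    (hH : Module.finrank ℝ H + 1 = Module.finrank ℝ V)
    (hK : Module.finrank ℝ K + 1 = Module.finrank ℝ V) (hne : H ≠ K) :
    Module.finrank ℝ (H ⊓ K : Submodule ℝ V) + 2 = Module.finrank ℝ V := by
  have h1 := Submodule.finrank_sup_add_finrank_inf_eq H K
  have h2 : H < H ⊔ K := by
    refine lt_of_le_of_ne le_sup_left fun h => hne ?_
    exact (Submodule.eq_of_le_of_finrank_eq (by rw [h]; exact le_sup_right) (by omega)).symm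
  have h3 := Submodule.finrank_lt_finrank_of_lt h2
  have h4 := Submodule.finrank_le (H ⊔ K)
  omega

theorem flats_finite {A : Set (Submodule ℝ V)} (hA : A.Finite) : (flats A).Finite := by
  refine (hA.finite_subsets.image sInf).subset ?_
  rintro X ⟨S, hS, rfl⟩
  exact ⟨S, hS, rfl⟩

variable [TopologicalSpace V] {A : Set (Submodule ℝ V)} {c₀ c : Chamber A}

/-- L₂ satisfies a triangle inequality and has one element on each edge; this is the lower bound for
the distance. -/
theorem encard_gallerySep_le_length {r r' : MinimalGallery A c₀ c}
    (p : (galleryGraph A c₀ c).Walk r r') : (gallerySep r r').encard ≤ p.length := by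
  induction p with
  | nil => simp [gallerySep]
  | @cons r s t hadj p ih =>
    have hsub : gallerySep r t ⊆ gallerySep r s ∪ gallerySep s t := by
      rintro X ⟨h1, h2⟩
      by_cases h : r.quot X = s.quot X
      · exact .inr ⟨h1, fun h' => h2 (h.trans h')⟩
      · exact .inl ⟨h1, h⟩
    have hadj' : (gallerySep r s).encard = 1 := hadj
    calc (gallerySep r t).encard ≤ (gallerySep r s).encard + (gallerySep s t).encard :=
          (Set.encard_le_encard hsub).trans (Set.encard_union_le _ _)
      _ ≤ 1 + p.length := by rw [hadj']; gcongr
      _ = _ := by rw [SimpleGraph.Walk.length_cons, add_comm]; simp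

theorem isAccessible_of_descent (hA : A.Finite) {r₀ : MinimalGallery A c₀ c}
    (H : ∀ r, r ≠ r₀ → ∃ r', ∃ X ∈ gallerySep r₀ r, gallerySep r' r = {X} ∧
      gallerySep r₀ r' = gallerySep r₀ r \ {X}) :
    IsAccessible (galleryGraph A c₀ c) gallerySep r₀ := by
  intro r
  refine le_antisymm ?_ (le_iInf encard_gallerySep_le_length)
  have hfin : ∀ r, (gallerySep r₀ r).Finite := fun r =>
    (flats_finite hA).subset fun X hX => hX.1.1.1
  obtain ⟨n, hn⟩ : ∃ n : ℕ, (gallerySep r₀ r).encard = n := ⟨_, (hfin r).encard_eq_coe⟩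
  rw [hn]
  induction n generalizing r with
  | zero =>
    by_cases h : r = r₀
    · simp [h]
    · obtain ⟨r', X, hX, -⟩ := H r h
      rw [Nat.cast_zero, Set.encard_eq_zero] at hn
      simp [hn] at hX
  | succ n ih =>
    by_cases h : r = r₀
    · simp [h]
    · obtain ⟨r', X, hX, h1, h2⟩ := H r h
      have h3 := Set.encard_sdiff_singleton_add_one hX
      rw [← h2, hn, Nat.cast_succ] at h3
      have h4 := ih r' (by simpa using h3)
      have hadj : (galleryGraph A c₀ c).Adj r' r :=
        show (gallerySep r' r).encard = 1 by rw [h1, Set.encard_singleton]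
      calc (galleryGraph A c₀ c).edist r₀ r
          ≤ (galleryGraph A c₀ c).edist r₀ r' + (galleryGraph A c₀ c).edist r' r :=
            SimpleGraph.edist_triangle
        _ ≤ n + 1 := by rw [SimpleGraph.edist_eq_one_iff_adj.2 hadj]; gcongr
        _ = _ := by simp

open Classical in
/-- A minimal gallery not respecting the flag can be moved one step closer, across a single
codimension-two flat, to the one that does. -/
theorem exists_descent [IsTopologicalAddGroup V] [ContinuousSMul ℝ V] [FiniteDimensional ℝ V]
    [Finite ι] {f : ι → V →ₗ[ℝ] ℝ} {cls : ι → ℕ} {w : ℕ → V} (hA : IsDefinedBy A f)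
    (hinj : Function.Injective fun i => LinearMap.ker (f i)) (hf : IsFlagged f cls w)
    (hrank : ∀ H ∈ A, Module.finrank ℝ H + 1 = Module.finrank ℝ V)
    (h₀ : negForms f c₀ = ∅) {r₀ r : MinimalGallery A c₀ c} {l₀ l : List ι}
    (hl₀ : IsAdmissible f l₀) (hl₀c : ∀ h, h ∈ l₀ ↔ h ∈ negForms f c)
    (hr₀ : IsCode (negForms f) r₀.1 l₀) (hl : IsAdmissible f l)
    (hlc : ∀ h, h ∈ l ↔ h ∈ negForms f c) (hr : IsCode (negForms f) r.1 l)
    (hs₀ : l₀.Pairwise fun h g => cls g ≤ cls h) (hs : ¬ l.Pairwise fun h g => cls g ≤ cls h) :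
    ∃ r', ∃ X ∈ gallerySep r₀ r, gallerySep r' r = {X} ∧
      gallerySep r₀ r' = gallerySep r₀ r \ {X} := by
  obtain ⟨P, M, R, e, k, hsplit, hek, hM, hl', hflip⟩ := hf.exists_flip hl hs
  have hperm : (P ++ M.reverse ++ R).Perm l := by
    rw [hsplit]; exact ((List.reverse_perm M).append_left P).append_right R
  obtain ⟨r', hr'⟩ := hl'.exists_minimalGallery hA hinj hf h₀ (c := c)
    (fun h => hperm.mem_iff.trans (hlc h))
  have memA : ∀ i, LinearMap.ker (f i) ∈ A := fun i => (hA.mem_iff _).2 ⟨i, rfl⟩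
  have hinf : ∀ {i j}, i ≠ j → Module.finrank ℝ
      (LinearMap.ker (f i) ⊓ LinearMap.ker (f j) : Submodule ℝ V) + 2 = Module.finrank ℝ V :=
    fun hij => finrank_inf_of_ne (hrank _ (memA _)) (hrank _ (memA _)) (hinj.ne hij)
  set X := LinearMap.ker (f e) ⊓ LinearMap.ker (f k) with hX
  have hMX : ∀ h, h ∈ M ↔ X ≤ LinearMap.ker (f h) := fun h =>
    (hM h).trans inPencil_iff_le_ker
  have heM : e ∈ M := (hMX e).2 inf_le_left
  have hkM : k ∈ M := (hMX k).2 inf_le_right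
  have hXsep : X ∈ sepFlats A c₀ c := by
    refine ⟨⟨⟨{LinearMap.ker (f e), LinearMap.ker (f k)}, ?_, by rw [sInf_pair]⟩, hinf hek⟩, ?_⟩
    · rintro H (rfl | rfl) <;> exact memA _
    · intro H hH hle
      obtain ⟨i, rfl⟩ := (hA.mem_iff H).1 hH
      rw [hA.sepHyperplanes_eq]
      refine ⟨i, ?_, rfl⟩
      rw [h₀, ← Set.bot_eq_empty, bot_symmDiff, ← hlc, hsplit]
      simp [(hMX i).2 hle]
  have hnd := hl.nodup
  rw [hsplit] at hnd
  have hMnd : M.Nodup := hnd.of_append_left.of_append_right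
  have fP : P.filter (fun i => X ≤ LinearMap.ker (f i)) = [] := by
    rw [List.filter_eq_nil_iff]
    intro a ha
    rw [decide_eq_true_iff, ← hMX]
    exact fun h => List.disjoint_of_nodup_append hnd.of_append_left ha h
  have fR : R.filter (fun i => X ≤ LinearMap.ker (f i)) = [] := by
    rw [List.filter_eq_nil_iff]
    intro a ha
    rw [decide_eq_true_iff, ← hMX]
    exact fun h => List.disjoint_of_nodup_append hnd (List.mem_append_right _ h) ha
  have fM : M.filter (fun i => X ≤ LinearMap.ker (f i)) = M := by
    rw [List.filter_eq_self]
    intro a ha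
    rw [decide_eq_true_iff, ← hMX]
    exact ha
  have fl : l.filter (fun i => X ≤ LinearMap.ker (f i)) = M := by
    rw [hsplit, List.filter_append, List.filter_append, fP, fM, fR]; simp
  have fl' : (P ++ M.reverse ++ R).filter (fun i => X ≤ LinearMap.ker (f i)) = M.reverse := by
    rw [List.filter_append, List.filter_append, fP, List.filter_reverse, fM, fR]; simp
  have fl₀ : l₀.filter (fun i => X ≤ LinearMap.ker (f i)) = M.reverse := by
    rw [← hflip l₀ hl₀ hs₀ fun h => (hl₀c h).trans (hlc h).symm]
    exact List.filter_congr fun i _ => by simp only [inPencil_iff_le_ker, hX]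
  have q1 : r₀.quot X = r'.quot X :=
    MinimalGallery.quot_eq_of_filter_eq hA X h₀ hl₀.nodup hl'.nodup hr₀ hr' (fl₀.trans fl'.symm)
  have q2 : r'.quot X ≠ r.quot X := by
    intro hq
    obtain ⟨a, s, has⟩ := List.exists_cons_of_ne_nil (List.ne_nil_of_mem heM)
    obtain ⟨b, t, hbt⟩ := List.exists_cons_of_ne_nil
      (List.ne_nil_of_mem (List.mem_reverse.2 heM))
    exact head_ne_head_reverse hMnd heM hkM hek has hbt
      (MinimalGallery.head_eq_of_quot_eq hA X h₀ hl.nodup hl'.nodup hr hr' hq.symm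
        (fl.trans has) (fl'.trans hbt))
  -- Two distinct hyperplanes of the pencil through `Y` would meet exactly in `Y` and exactly in
  -- `X`. So `Y` sees at most one element of the reversed block and does not notice the reversal.
  have q3 : ∀ Y ∈ sepFlats A c₀ c, Y ≠ X → r'.quot Y = r.quot Y := by
    intro Y hY hYX
    refine MinimalGallery.quot_eq_of_filter_eq hA Y h₀ hl'.nodup hl.nodup hr' hr ?_
    rw [hsplit, List.filter_append, List.filter_append, List.filter_append, List.filter_append,
      List.filter_reverse, reverse_eq_self_of_subsingleton (hMnd.filter _)]
    intro a ha b hb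
    rw [List.mem_filter, decide_eq_true_iff, hMX] at ha hb
    by_contra hab
    have h1 := hinf hab
    have h2 := hY.1.2
    have h3 : Module.finrank ℝ X + 2 = Module.finrank ℝ V := hinf hek
    exact hYX ((Submodule.eq_of_le_of_finrank_eq (le_inf ha.2 hb.2) (by omega)).trans
      (Submodule.eq_of_le_of_finrank_eq (le_inf ha.1 hb.1) (by omega)).symm)
  refine ⟨r', X, ⟨hXsep, by rw [q1]; exact q2⟩, ?_, ?_⟩
  · ext Y
    rw [Set.mem_singleton_iff]
    constructor
    · rintro ⟨h1, h2⟩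
      by_contra hne
      exact h2 (q3 Y h1 hne)
    · rintro rfl
      exact ⟨hXsep, q2⟩
  · ext Y
    rw [Set.mem_sdiff, Set.mem_singleton_iff]
    constructor
    · rintro ⟨h1, h2⟩
      have hne : Y ≠ X := by rintro rfl; exact h2 q1
      exact ⟨⟨h1, by rwa [← q3 Y h1 hne]⟩, hne⟩
    · rintro ⟨⟨h1, h2⟩, hne⟩
      exact ⟨h1, by rwa [q3 Y h1 hne]⟩

end Descent

/-! ### Grading the forms by a modular flag, and the conclusion -/

section FlagForms

variable {V : Type u} [AddCommGroup V] [Module ℝ V]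

theorem exists_class {d : ℕ} {X : Fin (d + 1) → Submodule ℝ V} (hmono : StrictMono X)
    (hbot : X 0 = ⊥) (htop : X (Fin.last d) = ⊤) {H : Submodule ℝ V} (hH : H ≠ ⊤) :
    ∃ n < d, ∀ j : Fin (d + 1), X j ≤ H ↔ (j : ℕ) ≤ n := by
  obtain ⟨m, hm, hmax⟩ := Set.exists_max_image {j | X j ≤ H} id (Set.toFinite _)
    ⟨0, by simp [hbot]⟩
  refine ⟨m, ?_, fun j => ⟨fun h => hmax j h, fun h => (hmono.monotone h).trans hm⟩⟩
  refine lt_of_le_of_ne (Nat.le_of_lt_succ m.2) fun h => hH ?_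
  have : m = Fin.last d := Fin.ext h
  rw [Set.mem_ofPred_eq, this, htop] at hm
  exact top_le_iff.1 hm

variable [FiniteDimensional ℝ V]

theorem exists_form_of_hyperplane {H : Submodule ℝ V}
    (hH : Module.finrank ℝ H + 1 = Module.finrank ℝ V) {x : V} (hx : x ∉ H) :
    ∃ f : V →ₗ[ℝ] ℝ, LinearMap.ker f = H ∧ 0 < f x := by
  obtain ⟨f, hf, hle⟩ := Submodule.exists_le_ker_of_lt_top H
    (lt_top_iff_ne_top.2 fun h => hx (h ▸ Submodule.mem_top))
  have hker : LinearMap.ker f = H := by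
    have := Module.Dual.finrank_ker_add_one_of_ne_zero hf
    exact (Submodule.eq_of_le_of_finrank_eq hle (by omega)).symm
  have h0 : f x ≠ 0 := fun h => hx (hker ▸ h)
  rcases h0.lt_or_gt with h | h
  · exact ⟨-f, by rw [← hker]; ext; simp, by simpa using h⟩
  · exact ⟨f, hker, h⟩

variable [TopologicalSpace V] {ι : Type*} {A : Set (Submodule ℝ V)} {f : ι → V →ₗ[ℝ] ℝ}

/-- All forms are nonnegative on the closure of the chamber, and its intersection with `X` spans
`X`. A form not vanishing on `X` is therefore positive somewhere on that intersection, and adding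
one such point per form makes all of them positive at once. -/
theorem exists_pos_of_incidentTo [Finite ι] (hA : IsDefinedBy A f) {c : Chamber A}
    (hc : negForms f c = ∅) {X : Submodule ℝ V} (hX : IncidentTo c X) :
    ∃ v ∈ X, ∀ i, ¬ X ≤ LinearMap.ker (f i) → 0 < f i v := by
  classical
  have := Fintype.ofFinite ι
  have hspan : Submodule.span ℝ (closure c.1 ∩ (X : Set V)) = X :=
    Submodule.eq_of_le_of_finrank_eq (Submodule.span_le.2 Set.inter_subset_right) hX
  have hnonneg : ∀ i, ∀ x ∈ closure c.1, 0 ≤ f i x := fun i =>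
    closure_minimal (fun x hx => ((hA.realizes hx).pos (by simp [hc])).le)
      (isClosed_le continuous_const (hA.continuous i))
  have key : ∀ i, ∃ u ∈ X, (∀ j, 0 ≤ f j u) ∧ (¬ X ≤ LinearMap.ker (f i) → 0 < f i u) := by
    intro i
    by_cases hi : X ≤ LinearMap.ker (f i)
    · exact ⟨0, X.zero_mem, by simp, fun h => (h hi).elim⟩
    · have : ∃ u ∈ closure c.1 ∩ (X : Set V), u ∉ LinearMap.ker (f i) := by
        by_contra! h
        exact hi (hspan ▸ Submodule.span_le.2 h)
      obtain ⟨u, hu, hne⟩ := this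
      exact ⟨u, hu.2, fun j => hnonneg j u hu.1,
        fun _ => lt_of_le_of_ne (hnonneg i u hu.1) (Ne.symm hne)⟩
  choose u huX hu0 hu using key
  refine ⟨∑ i, u i, X.sum_mem fun i _ => huX i, fun i hi => ?_⟩
  rw [map_sum]
  exact Finset.sum_pos' (fun j _ => hu0 j i) ⟨i, Finset.mem_univ i, hu i hi⟩

/-- A modular flag and a chamber incident to it grade the forms defining the arrangement. -/
theorem exists_isFlagged [Finite ι] (hA : IsDefinedBy A f)
    (hinj : Function.Injective fun i => LinearMap.ker (f i)) {c : Chamber A}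
    (hc : negForms f c = ∅) {d : ℕ} {X : Fin (d + 1) → Submodule ℝ V} (hX : IsModularFlag A X)
    (hcX : ∀ j, IncidentTo c (X j)) :
    ∃ cls w, IsFlagged f cls w ∧ (∀ i, cls i ≤ d) ∧
      ∀ (j : Fin (d + 1)) i, X j ≤ LinearMap.ker (f i) ↔ (j : ℕ) ≤ cls i := by
  obtain ⟨x, hx⟩ := c.nonempty
  have hne : ∀ i, LinearMap.ker (f i) ≠ ⊤ := fun i h =>
    hA.ne_zero hx i (by rw [← LinearMap.mem_ker, h]; trivial)
  choose cls hlt hcls using fun i => exists_class hX.strictMono hX.bot hX.top (hne i)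
  choose v hvX hv using fun j => exists_pos_of_incidentTo hA hc (hcX j)
  -- `w i` comes from X_{i+1}, the first member of the flag on which forms of class `i` do not
  -- vanish. All classes are below `d`, so the value 0 is never used by a form.
  let w : ℕ → V := fun i => if h : i < d then v (Fin.succ ⟨i, h⟩) else 0
  have hw : ∀ i (h : i < d), w i = v (Fin.succ ⟨i, h⟩) := fun i h => dif_pos h
  have hpos : ∀ h, 0 < f h (w (cls h)) := fun h => by
    rw [hw _ (hlt h)]
    refine hv _ h ?_
    rw [hcls]
    simp
  refine ⟨cls, w, ⟨fun h i hi => ?_, hpos, fun h g hhg hc => ?_, fun h g a e => ?_⟩,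
    fun i => (hlt i).le, fun j i => hcls i j⟩
  · have hid := hi.trans (hlt h)
    rw [hw i hid]
    exact (hcls h (Fin.succ ⟨i, hid⟩)).2 (by simpa using hi) (hvX _)
  · have memA : ∀ i, LinearMap.ker (f i) ∈ A := fun i => (hA.mem_iff _).2 ⟨i, rfl⟩
    let i : Fin d := ⟨cls h, hlt h⟩
    have e1 : X i.castSucc ≤ LinearMap.ker (f h) := (hcls h _).2 le_rfl
    have e2 : X i.castSucc ≤ LinearMap.ker (f g) := (hcls g _).2 hc.le
    have n1 : ¬ X i.succ ≤ LinearMap.ker (f h) := by rw [hcls]; simp [i]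
    have n2 : ¬ X i.succ ≤ LinearMap.ker (f g) := by rw [hcls]; simp [i, hc]
    have hmap : ∀ {K L : Submodule ℝ V}, X i.castSucc ≤ L →
        K.map (X i.castSucc).mkQ ≤ L.map (X i.castSucc).mkQ → K ≤ L := by
      intro K L hL h
      have := Submodule.map_le_iff_le_comap.1 h
      rwa [Submodule.comap_map_mkQ, sup_eq_right.2 hL] at this
    obtain ⟨_, ⟨K, hK, hXK, rfl⟩, h1, h2⟩ := (hX.modular i).modular _
      ⟨_, memA h, e1, rfl⟩ _ ⟨_, memA g, e2, rfl⟩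
      (fun e => hhg (hinj (le_antisymm (hmap e2 e.le) (hmap e1 e.ge))))
      (fun e => n1 (hmap e1 e)) (fun e => n2 (hmap e2 e))
    obtain ⟨k, rfl⟩ := (hA.mem_iff K).1 hK
    have h3 := hmap hXK h1
    have h4 : LinearMap.ker (f h) ⊓ LinearMap.ker (f g) ≤ LinearMap.ker (f k) :=
      hmap hXK ((Submodule.map_inf_le _).trans h2)
    have hck : cls h < cls k := (hcls k i.succ).1 h3
    obtain ⟨a, b, H⟩ := inPencil_iff_le_ker.2 h4
    have H' : ∀ y, f k y = a * f h y + b * f g y := fun y => by simp [H]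
    -- Vanishing of `a • f h + b • f g` at `w (cls h)` fixes the ratio of `a` to `b`: the form `f k`
    -- is `a * f h (w (cls h))` times the difference of the slopes, whence the factor `t` below.
    have h5 : f k (w (cls h)) = 0 := by
      rw [hw _ (hlt h)]
      exact h3 (hvX _)
    have p1 := hpos h
    have p2 := hpos g
    have h6 := H' (w (cls h))
    rw [h5] at h6
    rw [← hc] at p2
    have ha : a ≠ 0 := by
      rintro rfl
      have hb : b = 0 := by
        have : b * f g (w (cls h)) = 0 := by linarith
        exact (mul_eq_zero.1 this).resolve_right p2.ne'
      exact hA.ne_zero hx k (by rw [H', hb]; ring)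
    refine ⟨k, hck, (a * f h (w (cls h)))⁻¹, inv_ne_zero (mul_ne_zero ha p1.ne'), fun y => ?_⟩
    rw [H', slope, slope, ← hc]
    have hb : b = -(a * f h (w (cls h))) / f g (w (cls h)) := by
      rw [eq_div_iff p2.ne']; linarith
    rw [hb]
    have := p1.ne'
    have := p2.ne'
    field_simp
    ring
  · refine hinj (show LinearMap.ker (f h) = LinearMap.ker (f g) from ?_)
    have ha : a ≠ 0 := by
      rintro rfl
      exact hA.ne_zero hx h (by simp [e])
    rw [e, LinearMap.ker_smul _ _ ha]

/-- For a modular flag `F` and a chamber `c₀` incident to it, there is a unique minimal gallery from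
`c₀` to `c` incident to `F`, and it is accessible in the graph of minimal galleries. -/
theorem existsUnique_and_isAccessible [IsTopologicalAddGroup V] [ContinuousSMul ℝ V] [T2Space V]
    (hA : IsCentralEssential A) {d : ℕ} {F : Fin (d + 1) → Submodule ℝ V}
    (hF : IsModularFlag A F) {c₀ : Chamber A} (hc₀ : ∀ i, IncidentTo c₀ (F i)) (c : Chamber A) :
    (∃! r₀ : MinimalGallery A c₀ c, r₀.IncidentToFlag F) ∧
    ∀ r₀ : MinimalGallery A c₀ c, r₀.IncidentToFlag F →
      IsAccessible (galleryGraph A c₀ c) gallerySep r₀ := by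
  have := hA.finite.to_subtype
  obtain ⟨x₀, hx₀⟩ := c₀.nonempty
  -- Normalizing the forms to be positive on `c₀` gives `c₀` the empty label, so that galleries from
  -- `c₀` only add elements.
  choose f hker hpos using fun H : A => exists_form_of_hyperplane (hA.hyperplane H.1 H.2)
    (c₀.subset_complement hx₀ H.1 H.2)
  have hdef : IsDefinedBy A f :=
    ⟨fun H => (f H).continuous_of_finiteDimensional, fun H =>
      ⟨fun h => ⟨⟨H, h⟩, hker _⟩, fun ⟨K, hK⟩ => hK ▸ hker K ▸ K.2⟩⟩
  have hinj : Function.Injective fun i => LinearMap.ker (f i) := fun H K h =>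
    Subtype.ext (by simpa only [hker] using h)
  have h₀ : negForms f c₀ = ∅ := by
    ext H
    simp [← hdef.neg_iff hx₀, (hpos H).le]
  obtain ⟨cls, w, hf, hle, hcls⟩ := exists_isFlagged hdef hinj h₀ hF hc₀
  have incident : ∀ {r : MinimalGallery A c₀ c} {l}, IsAdmissible f l →
      IsCode (negForms f) r.1 l →
      (r.IncidentToFlag F ↔ l.Pairwise fun h g => cls g ≤ cls h) := fun hl hr =>
    MinimalGallery.incidentToFlag_iff hdef hl.nodup h₀ hr hcls hle
  have code := fun r : MinimalGallery A c₀ c => r.exists_isCode hdef hinj hf h₀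
  have unique : ∀ r r' : MinimalGallery A c₀ c, r.IncidentToFlag F → r'.IncidentToFlag F →
      r = r' := by
    intro r r' h h'
    obtain ⟨l, hl, hlc, hr⟩ := code r
    obtain ⟨l', hl', hlc', hr'⟩ := code r'
    have := hf.sorted_unique hl hl' (fun i => (hlc i).trans (hlc' i).symm)
      ((incident hl hr).1 h) ((incident hl' hr').1 h')
    subst this
    exact Subtype.ext (hr.walk_eq hdef.negForms_injective hr')
  refine ⟨?_, fun r₀ hr₀ => ?_⟩
  · obtain ⟨x, hx⟩ := c.nonempty
    obtain ⟨l, hl, hs, hlc⟩ := hf.exists_sorted (hdef.realizes hx)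
    obtain ⟨r, hr⟩ := hl.exists_minimalGallery hdef hinj hf h₀ hlc
    have hi := (incident hl hr).2 hs
    exact ⟨r, hi, fun r' hr' => unique r' r hr' hi⟩
  · refine isAccessible_of_descent hA.finite fun r hne => ?_
    obtain ⟨l₀, hl₀, hl₀c, hc₀⟩ := code r₀
    obtain ⟨l, hl, hlc, hr⟩ := code r
    exact exists_descent hdef hinj hf hA.hyperplane h₀ hl₀ hl₀c hc₀ hl hlc hr
      ((incident hl₀ hc₀).1 hr₀) fun hs => hne (unique r r₀ ((incident hl hr).2 hs) hr₀)

end FlagForms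

end Arrangement

theorem mainTheorem3 (d : ℕ)
    (A : Set (Submodule ℝ (EuclideanSpace ℝ (Fin d))))
    (hA : Arrangement.IsCentralEssential A)
    (hss : Arrangement.IsSupersolvable A)
    (F : Fin (d + 1) → Submodule ℝ (EuclideanSpace ℝ (Fin d)))
    (hF : Arrangement.IsModularFlag A F)
    (c₀ : Arrangement.Chamber A)
    (hc₀ : ∀ i, Arrangement.IncidentTo c₀ (F i))
    (c : Arrangement.Chamber A) :
    (∃! r₀ : Arrangement.MinimalGallery A c₀ c, r₀.IncidentToFlag F) ∧
    ∀ r₀ : Arrangement.MinimalGallery A c₀ c, r₀.IncidentToFlag F →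
      Arrangement.IsAccessible (Arrangement.galleryGraph A c₀ c)
        Arrangement.gallerySep r₀ :=
  Arrangement.existsUnique_and_isAccessible hA hF hc₀ c
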